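/- All Banach spaces are real. A bounded operator $V:E\to E$ is weakly compact if it maps the closed unit ball of $E$ to a relatively weakly compact set. A Banach space $E$ has the (bounded) weakly compact approximation property (W.A.P.) if there is a constant $C<\infty$ such that for every weakly compact set $D\subset E$ and every $\varepsilon>0$ there is a weakly compact operator $V:E\to E$ with $\sup_{x\in D}\|x-Vx\|<\varepsilon$ and $\|V\|\le C$. It has the unbounded W.A.P. if for every weakly compact set $D\subset E$ and every $\varepsilon>0$ there is a weakly compact operator $V:E\to E$ with $\sup_{x\in D}\|x-Vx\|<\varepsilon$ (no bound on $\|V\|$). Let $\mathcal T=\bigcup_{n\ge 0}\{0,1\}^n$ be the infinite binary tree, ordered by $\alpha\le\beta$ if and only if $\alpha$ is an initial segment of $\beta$. A segment is a set $S=\{\gamma\in\mathcal T:\alpha\le\gamma\le\beta\}$ with $\alpha\le\beta$ in $\mathcal T$. James' tree space $JT$ is the Banach space of all $x:\mathcal T\to\mathbb R$ with $$\|x\|=\sup\Big(\sum_{j=1}^k\Big(\sum_{\alpha\in S_j}x(\alpha)\Big)^2\Big)^{1/2}<\infty,$$ where the supremum is over all finite families $S_1,\dots,S_k$ of pairwise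 disjoint segments. For $\alpha\in\mathcal T$ let $f_\alpha\in JT$ be the function that is $1$ at $\alpha$ and $0$ elsewhere. For $n=1,2,\dots$ let $\mathcal T_n$ be the set of nodes having at most $n$ entries equal to $1$, and let $X_n\subset JT$ be the closed linear span of $\{f_\alpha:\alpha\in\mathcal T_n\}$. Let $Z=\ell^1(X_n)$ be the direct $\ell^1$-sum of $X_1,X_2,\dots$. Then $Z$ has the unbounded W.A.P., but $Z$ does not have the (bounded) W.A.P. Hence the bounded W.A.P. is strictly stronger than the unbounded W.A.P.: every Banach space with the W.A.P. has the unbounded W.A.P., and there is a Banach space that has the unbounded W.A.P. but not the W.A.P. -/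

import Mathlib

noncomputable section

namespace WAP

/-! ### Weakly compact approximation properties of real normed spaces -/

section Approximation

variable (E : Type*) [NormedAddCommGroup E] [NormedSpace ℝ E]

/-- A subset of `E` is weakly compact if it is compact for the weak topology `σ(E, E*)`. -/
def IsWeaklyCompact (D : Set E) : Prop :=
  IsCompact (toWeakSpace ℝ E '' D)

/-- A bounded operator is weakly compact if the image of the closed unit ball is relatively
compact for the weak topology. -/
def IsWeaklyCompactOperator (V : E →L[ℝ] E) : Prop :=
  IsCompact (closure (toWeakSpace ℝ E '' (V '' Metric.closedBall 0 1)))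

/-- The (bounded) weakly compact approximation property. The supremum `sup_{x ∈ D} ‖x - V x‖` is
formed in `[0, ∞]`. -/
def HasBoundedWAP : Prop :=
  ∃ C : ℝ, ∀ D : Set E, IsWeaklyCompact E D → ∀ ε : ℝ, 0 < ε →
    ∃ V : E →L[ℝ] E, IsWeaklyCompactOperator E V ∧
      (⨆ x ∈ D, ‖x - V x‖ₑ) < ENNReal.ofReal ε ∧ ‖V‖ ≤ C

/-- The unbounded weakly compact approximation property: no uniform bound on `‖V‖`. -/
def HasUnboundedWAP : Prop :=
  ∀ D : Set E, IsWeaklyCompact E D → ∀ ε : ℝ, 0 < ε →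
    ∃ V : E →L[ℝ] E, IsWeaklyCompactOperator E V ∧
      (⨆ x ∈ D, ‖x - V x‖ₑ) < ENNReal.ofReal ε

end Approximation

/-! ### James' tree space -/

/-- Nodes of the infinite binary tree: finite `0`-`1` sequences, with `true` standing for `1`.
The tree order `α ≤ β` is "`α` is an initial segment of `β`", written `α <+: β`. -/
abbrev Node : Type := List Bool

/-- `S` is a segment `{γ : α ≤ γ ≤ β}` for some nodes `α ≤ β`. -/
def IsSegment (S : Finset Node) : Prop :=
  ∃ α β : Node, α <+: β ∧ ∀ γ : Node, γ ∈ S ↔ α <+: γ ∧ γ <+: β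

/-- A finite family of pairwise disjoint segments. -/
def SegmentFamily : Type :=
  {F : Finset (Finset Node) //
    (∀ S ∈ F, IsSegment S) ∧ (F : Set (Finset Node)).PairwiseDisjoint id}

/-- The quantity `(∑_j S_j^*(x)^2)^{1/2}`, where `S^*(x) = ∑_{α ∈ S} x_α`. -/
def familyNorm (F : SegmentFamily) (x : Node → ℝ) : ℝ :=
  √(∑ S ∈ F.1, (∑ α ∈ S, x α) ^ 2)

lemma familyNorm_nonneg (F : SegmentFamily) (x : Node → ℝ) : 0 ≤ familyNorm F x :=
  Real.sqrt_nonneg _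

lemma familyNorm_eq (F : SegmentFamily) (x : Node → ℝ) :
    familyNorm F x = ‖(WithLp.toLp 2 (fun S : F.1 => ∑ α ∈ S.1, x α) : EuclideanSpace ℝ F.1)‖ := by
  rw [EuclideanSpace.norm_eq, familyNorm]
  congr 1
  rw [← Finset.sum_coe_sort]
  simp

lemma familyNorm_add_le (F : SegmentFamily) (x y : Node → ℝ) :
    familyNorm F (x + y) ≤ familyNorm F x + familyNorm F y := by
  rw [familyNorm_eq, familyNorm_eq, familyNorm_eq]
  refine le_trans (le_of_eq ?_) (norm_add_le _ _)
  congr 1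
  ext S
  simp [Finset.sum_add_distrib]

lemma familyNorm_smul (F : SegmentFamily) (c : ℝ) (x : Node → ℝ) :
    familyNorm F (c • x) = |c| * familyNorm F x := by
  rw [familyNorm_eq, familyNorm_eq, ← Real.norm_eq_abs, ← norm_smul]
  congr 1
  ext S
  simp [Finset.mul_sum]

/-- The functions on the tree for which the supremum defining the norm is finite. -/
def jtSubmodule : Submodule ℝ (Node → ℝ) where
  carrier := {x | BddAbove (Set.range fun F : SegmentFamily => familyNorm F x)}
  zero_mem' := by
    refine ⟨0, ?_⟩
    rintro _ ⟨F, rfl⟩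
    simp [familyNorm]
  add_mem' := by
    rintro x y ⟨a, ha⟩ ⟨b, hb⟩
    refine ⟨a + b, ?_⟩
    rintro _ ⟨F, rfl⟩
    exact (familyNorm_add_le F x y).trans (add_le_add (ha ⟨F, rfl⟩) (hb ⟨F, rfl⟩))
  smul_mem' := by
    rintro c x ⟨a, ha⟩
    refine ⟨|c| * a, ?_⟩
    rintro _ ⟨F, rfl⟩
    simp only [familyNorm_smul]
    exact mul_le_mul_of_nonneg_left (ha ⟨F, rfl⟩) (abs_nonneg c)

/-- James' tree space. A separate type (rather than the coerced submodule), so that it does not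
carry the topology of pointwise convergence. -/
def JT : Type := jtSubmodule

namespace JT

instance : AddCommGroup JT := inferInstanceAs (AddCommGroup jtSubmodule)

instance : Module ℝ JT := inferInstanceAs (Module ℝ jtSubmodule)

/-- The coefficient function `α ↦ a_α` of an element of `JT`. -/
def coeff (x : JT) : Node → ℝ := x.1

/-- The element of `JT` with given coefficients. -/
def mk (x : Node → ℝ) (hx : x ∈ jtSubmodule) : JT := (⟨x, hx⟩ : jtSubmodule)

/-- The norm `sup (∑_j S_j^*(x)^2)^{1/2}` over finite families of disjoint segments. -/
instance : Norm JT := ⟨fun x => ⨆ F : SegmentFamily, familyNorm F x.coeff⟩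

lemma norm_def (x : JT) : ‖x‖ = ⨆ F : SegmentFamily, familyNorm F x.coeff := rfl

lemma coeff_add (x y : JT) : (x + y).coeff = x.coeff + y.coeff := rfl

lemma coeff_sub (x y : JT) : (x - y).coeff = x.coeff - y.coeff := rfl

lemma coeff_smul (c : ℝ) (x : JT) : (c • x).coeff = c • x.coeff := rfl

lemma coeff_injective : Function.Injective coeff := fun _ _ h => Subtype.ext h

instance : Nonempty SegmentFamily := ⟨⟨∅, by simp, by simp⟩⟩

lemma familyNorm_le_norm (F : SegmentFamily) (x : JT) : familyNorm F x.coeff ≤ ‖x‖ :=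
  le_ciSup (f := fun F : SegmentFamily => familyNorm F x.coeff) x.2 F

lemma isSegment_singleton (α : Node) : IsSegment {α} := by
  refine ⟨α, α, List.prefix_rfl, fun γ => ?_⟩
  rw [Finset.mem_singleton]
  constructor
  · rintro rfl
    exact ⟨List.prefix_rfl, List.prefix_rfl⟩
  · rintro ⟨h1, h2⟩
    exact h2.eq_of_length_le h1.length_le

/-- The family consisting of the one-node segment `{α}`. -/
def singletonFamily (α : Node) : SegmentFamily :=
  ⟨{{α}}, by simpa using isSegment_singleton α, by simp⟩

lemma abs_coeff_le_norm (x : JT) (α : Node) : |x.coeff α| ≤ ‖x‖ := by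
  refine le_trans (le_of_eq ?_) (familyNorm_le_norm (singletonFamily α) x)
  simp [familyNorm, singletonFamily, Real.sqrt_sq_eq_abs]

lemma normCore : NormedSpace.Core ℝ JT where
  norm_nonneg x := Real.iSup_nonneg fun F => familyNorm_nonneg F _
  norm_smul c x := by
    simp only [norm_def, coeff_smul, familyNorm_smul]
    rw [Real.norm_eq_abs, Real.mul_iSup_of_nonneg (abs_nonneg c)]
  norm_triangle x y := ciSup_le fun F =>
    (familyNorm_add_le F _ _).trans
      (add_le_add (familyNorm_le_norm F x) (familyNorm_le_norm F y))
  norm_eq_zero_iff x := by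
    constructor
    · intro h
      apply coeff_injective
      funext α
      have := abs_coeff_le_norm x α
      rw [h] at this
      exact abs_nonpos_iff.mp this
    · rintro rfl
      have h0 : (0 : JT).coeff = 0 := rfl
      simp [norm_def, h0, familyNorm]

instance : NormedAddCommGroup JT := NormedAddCommGroup.ofCore normCore

instance : NormedSpace ℝ JT := NormedSpace.ofCore normCore

lemma continuous_familyNorm (F : SegmentFamily) : Continuous (familyNorm F) := by
  unfold familyNorm
  fun_prop

/-- `JT` is a Banach space. -/
instance : CompleteSpace JT := by
  refine Metric.complete_of_cauchySeq_tendsto fun u hu => ?_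
  have hc : ∀ α, ∃ a, Filter.Tendsto (fun n => (u n).coeff α) Filter.atTop (nhds a) := by
    intro α
    apply cauchySeq_tendsto_of_complete
    rw [Metric.cauchySeq_iff] at hu ⊢
    intro ε hε
    obtain ⟨N, hN⟩ := hu ε hε
    refine ⟨N, fun m hm n hn => lt_of_le_of_lt ?_ (hN m hm n hn)⟩
    rw [dist_eq_norm, dist_eq_norm, Real.norm_eq_abs]
    exact abs_coeff_le_norm (u m - u n) α
  choose y hy using hc
  have hy' : Filter.Tendsto (fun n => (u n).coeff) Filter.atTop (nhds y) :=
    tendsto_pi_nhds.mpr hy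
  have key : ∀ ε > 0, ∃ N, ∀ n ≥ N, ∀ F : SegmentFamily,
      familyNorm F ((u n).coeff - y) ≤ ε := by
    intro ε hε
    obtain ⟨N, hN⟩ := Metric.cauchySeq_iff.mp hu ε hε
    refine ⟨N, fun n hn F => ?_⟩
    have ht : Filter.Tendsto (fun m => familyNorm F ((u n).coeff - (u m).coeff)) Filter.atTop
        (nhds (familyNorm F ((u n).coeff - y))) :=
      ((continuous_familyNorm F).tendsto _).comp (tendsto_const_nhds.sub hy')
    refine le_of_tendsto ht (Filter.eventually_atTop.mpr ⟨N, fun m hm => ?_⟩)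
    have h1 := hN n hn m hm
    rw [dist_eq_norm] at h1
    exact (familyNorm_le_norm F (u n - u m)).trans h1.le
  have hmem : y ∈ jtSubmodule := by
    obtain ⟨N, hN⟩ := key 1 one_pos
    have h1 : (u N).coeff - y ∈ jtSubmodule := by
      refine ⟨1, ?_⟩
      rintro _ ⟨F, rfl⟩
      exact hN N le_rfl F
    have h2 := jtSubmodule.sub_mem (u N).2 h1
    have h3 : (u N).1 - ((u N).coeff - y) = y := by
      simp [coeff]
    rwa [h3] at h2
  refine ⟨mk y hmem, Metric.tendsto_atTop.mpr fun ε hε => ?_⟩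
  obtain ⟨N, hN⟩ := key (ε / 2) (half_pos hε)
  refine ⟨N, fun n hn => ?_⟩
  rw [dist_eq_norm]
  refine lt_of_le_of_lt ?_ (half_lt_self hε)
  exact ciSup_le fun F => hN n hn F

lemma single_mem (α : Node) : Pi.single α (1 : ℝ) ∈ jtSubmodule := by
  refine ⟨1, ?_⟩
  rintro _ ⟨⟨F, hF, hd⟩, rfl⟩
  simp only [familyNorm]
  rw [Real.sqrt_le_left zero_le_one, one_pow]
  have hS : ∀ S : Finset Node,
      (∑ β ∈ S, (Pi.single α (1 : ℝ) : Node → ℝ) β) ^ 2 = if α ∈ S then 1 else 0 := by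
    intro S
    simp [Finset.sum_pi_single']
  simp only [hS]
  rw [← Finset.sum_filter]
  simp only [Finset.sum_const, nsmul_eq_mul, mul_one]
  have : (F.filter fun S => α ∈ S).card ≤ 1 := by
    rw [Finset.card_le_one]
    intro S hS1 T hT1
    rw [Finset.mem_filter] at hS1 hT1
    by_contra hne
    exact Finset.disjoint_left.mp (hd hS1.1 hT1.1 hne) hS1.2 hT1.2
  exact_mod_cast this

/-- The node vector `f_α`. -/
def nodeVec (α : Node) : JT := mk (Pi.single α 1) (single_mem α)

end JT

/-- The subtree `T_n` of the nodes with at most `n` entries equal to `1`. -/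
def subtree (n : ℕ) : Set Node := {α | α.count true ≤ n}

/-- `X_n`, the closed linear span in `JT` of the node vectors `f_α` with `α ∈ T_n`. -/
def X (n : ℕ) : Submodule ℝ JT :=
  (Submodule.span ℝ (JT.nodeVec '' subtree n)).topologicalClosure

instance (n : ℕ) : CompleteSpace (X n) :=
  inferInstanceAs
    (CompleteSpace (Submodule.span ℝ (JT.nodeVec '' subtree n)).topologicalClosure)

/-- The direct `ℓ¹`-sum `Z = ℓ¹(X_n)` over `n = 1, 2, …`. -/
abbrev Z : Type := lp (fun n : ℕ+ => X n) 1

end WAP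

end

/-! A trunk is a branch p000…, where p does not end in 0. The trunks partition the tree, and a path
inside T_n meets at most n + 1 of them.

The bounded property fails because of the vectors f_α - f_{α0}. For α in T_n a path sees at most n +
2 of them, so sums of k of them have norm O(√k), and together with 0 they form a weakly compact set
(`isWeaklyCompact_diffSet`). Let V be weakly compact and move each of them by at most 1/4. Along
every trunk the vectors V f have a weak cluster point. Build a path that turns n times, leaving the
i-th trunk at a node c, and choose on that trunk an early node b and a late node a such that V f_a
and V f_b nearly agree along the path. Then V(f_a - f_b + f_c - f_{c0}) has path sum at least 1/2,
while the n such vectors add up to norm at most 7√n. Hence ‖V‖ ≥ √n/14, and no bound serves all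
summands X_n (`le_norm_of_approximates`).

For the unbounded property of X_n, cut each trunk into blocks and write the identity as a sum of
block operators, then correct each block after the first on its trunk so that its values sum to zero
along the trunk. Such a block is seen only by paths that leave the trunk inside it. This gives an
upper 2-estimate with constant 6(n + 1); the lower 2-estimate comes from disjointness of supports.
So the sum W of the corrected operators converges, weakly uniformly on the ball, and every term
depends on finitely many coordinates. As the ball of JT is compact for pointwise convergence, W is
weakly compact (`exists_sum_blockOp`). The corrections measure tails of branch sums; these tend to
zero pointwise on a weakly compact set, so suitable convex averages tend to zero uniformly
(`exists_small_average`). Cutting with these averages makes x - W x small (`hasUnboundedWAP_X`).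

A weakly compact subset of Z has uniformly small tails by a gliding hump
(`IsWeaklyCompact.exists_tail_le`), so finitely many summands suffice for Z. -/

noncomputable section

namespace WAP

/-! ### Intervals of the tree -/

/-- A finite set of nodes that is a chain and order-convex: a segment or the empty set. -/
def IsInterval (S : Finset Node) : Prop :=
  (∀ a ∈ S, ∀ b ∈ S, a <+: b ∨ b <+: a) ∧
    ∀ a ∈ S, ∀ b ∈ S, ∀ c : Node, a <+: c → c <+: b → c ∈ S

/-- An order-convex set of nodes. -/
def IsOrdConvex (A : Set Node) : Prop :=
  ∀ a ∈ A, ∀ b ∈ A, ∀ c : Node, a <+: c → c <+: b → c ∈ A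

lemma IsSegment.isInterval {S : Finset Node} (h : IsSegment S) : IsInterval S := by
  obtain ⟨α, β, -, hS⟩ := h
  refine ⟨fun a ha b hb => ?_, fun a ha b hb c hac hcb => ?_⟩
  · exact List.prefix_or_prefix_of_prefix ((hS a).1 ha).2 ((hS b).1 hb).2
  · exact (hS c).2 ⟨((hS a).1 ha).1.trans hac, hcb.trans ((hS b).1 hb).2⟩

lemma IsInterval.isSegment {S : Finset Node} (h : IsInterval S) (hne : S.Nonempty) :
    IsSegment S := by
  obtain ⟨α, hα, hmin⟩ := S.exists_min_image List.length hne
  obtain ⟨β, hβ, hmax⟩ := S.exists_max_image List.length hne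
  have low : ∀ γ ∈ S, α <+: γ := fun γ hγ => by
    rcases h.1 α hα γ hγ with h1 | h1
    · exact h1
    · rw [h1.eq_of_length_le (hmin γ hγ)]
  have high : ∀ γ ∈ S, γ <+: β := fun γ hγ => by
    rcases h.1 γ hγ β hβ with h1 | h1
    · exact h1
    · rw [h1.eq_of_length_le (hmax γ hγ)]
  exact ⟨α, β, low β hβ, fun γ => ⟨fun hγ => ⟨low γ hγ, high γ hγ⟩,
    fun hγ => h.2 α hα β hβ γ hγ.1 hγ.2⟩⟩

open Classical in
lemma IsInterval.filter {S : Finset Node} (h : IsInterval S) {A : Set Node}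
    (hA : IsOrdConvex A) : IsInterval (S.filter (· ∈ A)) := by
  refine ⟨fun a ha b hb => h.1 a (Finset.mem_filter.1 ha).1 b (Finset.mem_filter.1 hb).1,
    fun a ha b hb c hac hcb => ?_⟩
  rw [Finset.mem_filter] at ha hb ⊢
  exact ⟨h.2 a ha.1 b hb.1 c hac hcb, hA a ha.2 b hb.2 c hac hcb⟩

/-- The set of initial segments of a node. -/
def below (γ : Node) : Finset Node := γ.inits.toFinset

@[simp] lemma mem_below {α γ : Node} : α ∈ below γ ↔ α <+: γ := by
  simp [below]

lemma isInterval_below (γ : Node) : IsInterval (below γ) := by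
  refine ⟨fun a ha b hb => ?_, fun a ha b hb c hac hcb => ?_⟩
  · exact List.prefix_or_prefix_of_prefix (mem_below.1 ha) (mem_below.1 hb)
  · exact mem_below.2 (hcb.trans (mem_below.1 hb))

lemma isInterval_below_sdiff (α β : Node) : IsInterval (below β \ below α) := by
  refine ⟨fun a ha b hb => ?_, fun a ha b hb c hac hcb => ?_⟩
  · rw [Finset.mem_sdiff] at ha hb
    exact (isInterval_below β).1 a ha.1 b hb.1
  · rw [Finset.mem_sdiff] at ha hb ⊢
    refine ⟨(isInterval_below β).2 a ha.1 b hb.1 c hac hcb, fun h => ha.2 ?_⟩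
    exact mem_below.2 (hac.trans (mem_below.1 h))

lemma below_subset {α β : Node} (h : α <+: β) : below α ⊆ below β := fun _ hγ =>
  mem_below.2 ((mem_below.1 hγ).trans h)

/-- The sum of `x` along the path from the root to `γ`. -/
def pathSum (γ : Node) (x : Node → ℝ) : ℝ := ∑ α ∈ below γ, x α

lemma pathSum_sub_pathSum {α β : Node} (h : α <+: β) (x : Node → ℝ) :
    pathSum β x - pathSum α x = ∑ γ ∈ below β \ below α, x γ := by
  rw [pathSum, pathSum, ← Finset.sum_sdiff (below_subset h)]
  ring

/-- The path to the top of the segment minus the path to the parent of its bottom; the parent is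
missing exactly when the bottom is the root. This reduces all upper estimates to path sums. -/
lemma IsSegment.sum_eq {S : Finset Node} (h : IsSegment S) :
    ∃ β, (∀ x : Node → ℝ, ∑ γ ∈ S, x γ = pathSum β x) ∨
      ∃ α, ∀ x : Node → ℝ, ∑ γ ∈ S, x γ = pathSum β x - pathSum α x := by
  obtain ⟨α, β, hαβ, hS⟩ := h
  refine ⟨β, ?_⟩
  rcases List.eq_nil_or_concat' α with rfl | ⟨α', b, rfl⟩
  · left
    intro x
    refine Finset.sum_congr ?_ fun _ _ => rfl
    ext γ
    simp [hS]
  · right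
    refine ⟨α', fun x => ?_⟩
    rw [pathSum_sub_pathSum ((List.prefix_append _ _).trans hαβ)]
    refine Finset.sum_congr ?_ fun _ _ => rfl
    ext γ
    rw [hS, Finset.mem_sdiff, mem_below, mem_below, and_comm]
    refine and_congr_right fun hγ => ⟨fun h1 h2 => ?_, fun h1 => ?_⟩
    · have := (h1.trans h2).length_le
      simp at this
    · rcases List.prefix_or_prefix_of_prefix hαβ hγ with h2 | h2
      · exact h2
      · rcases List.prefix_concat_iff.1 h2 with h3 | h3
        · rw [h3]
        · exact absurd h3 h1

lemma IsSegment.abs_sum_le {S : Finset Node} (h : IsSegment S) {x : Node → ℝ} {M : ℝ}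
    (hx : ∀ γ, |pathSum γ x| ≤ M) : |∑ γ ∈ S, x γ| ≤ 2 * M := by
  have hM : 0 ≤ M := (abs_nonneg _).trans (hx [])
  obtain ⟨β, h | ⟨α, h⟩⟩ := h.sum_eq
  · rw [h]
    linarith [hx β]
  · rw [h]
    linarith [hx β, hx α, abs_sub (pathSum β x) (pathSum α x)]

namespace JT

/-! ### Sums over disjoint intervals -/

lemma ext_coeff {x y : JT} (h : ∀ α, x.coeff α = y.coeff α) : x = y :=
  coeff_injective (funext h)

@[simp] lemma coeff_mk (x : Node → ℝ) (hx : x ∈ jtSubmodule) : (mk x hx).coeff = x := rfl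

@[simp] lemma coeff_zero (α : Node) : (0 : JT).coeff α = 0 := rfl

/-- Empty intervals contribute nothing, and on the others disjointness makes the indexing injective.
Admitting empty intervals allows segments to be intersected freely with order-convex sets. -/
lemma sum_sq_le_norm_sq {ι : Type*} (s : Finset ι) (S : ι → Finset Node)
    (hS : ∀ i ∈ s, IsInterval (S i)) (hd : (s : Set ι).PairwiseDisjoint S) (x : JT) :
    ∑ i ∈ s, (∑ α ∈ S i, x.coeff α) ^ 2 ≤ ‖x‖ ^ 2 := by
  classical
  set t := s.filter fun i => (S i).Nonempty with ht
  have hsub : t ⊆ s := Finset.filter_subset _ _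
  have hinj : Set.InjOn S t := by
    intro i hi j hj hij
    by_contra hne
    have h1 := hd (hsub hi) (hsub hj) hne
    rw [Function.onFun, hij, disjoint_self] at h1
    have h2 := (Finset.mem_filter.1 hj).2
    rw [h1] at h2
    simp at h2
  have h1 : ∑ i ∈ s, (∑ α ∈ S i, x.coeff α) ^ 2 = ∑ T ∈ t.image S, (∑ α ∈ T, x.coeff α) ^ 2 := by
    rw [Finset.sum_image hinj]
    symm
    refine Finset.sum_subset hsub fun i hi hit => ?_
    have : S i = ∅ := by
      by_contra h
      exact hit (Finset.mem_filter.2 ⟨hi, Finset.nonempty_iff_ne_empty.2 h⟩)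
    simp [this]
  have hseg : ∀ T ∈ t.image S, IsSegment T := by
    intro T hT
    obtain ⟨i, hi, rfl⟩ := Finset.mem_image.1 hT
    exact (hS i (hsub hi)).isSegment (Finset.mem_filter.1 hi).2
  have hdis : ((t.image S : Finset (Finset Node)) : Set (Finset Node)).PairwiseDisjoint id := by
    intro T hT T' hT' hne
    obtain ⟨i, hi, rfl⟩ := Finset.mem_image.1 hT
    obtain ⟨j, hj, rfl⟩ := Finset.mem_image.1 hT'
    exact hd (hsub hi) (hsub hj) fun h => hne (by rw [h])
  have h2 := familyNorm_le_norm ⟨t.image S, hseg, hdis⟩ x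
  rw [h1]
  calc _ = familyNorm ⟨t.image S, hseg, hdis⟩ x.coeff ^ 2 := by
        unfold familyNorm
        rw [Real.sq_sqrt (Finset.sum_nonneg fun _ _ => sq_nonneg _)]
    _ ≤ ‖x‖ ^ 2 := by gcongr; exact familyNorm_nonneg _ _

lemma abs_sum_le_norm {S : Finset Node} (hS : IsInterval S) (x : JT) :
    |∑ α ∈ S, x.coeff α| ≤ ‖x‖ := by
  have := sum_sq_le_norm_sq {()} (fun _ => S) (by simpa using hS) (by simp) x
  simp only [Finset.sum_singleton] at this
  exact abs_le_of_sq_le_sq this (norm_nonneg x)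

lemma familyNorm_le_of_sum_sq_le {F : SegmentFamily} {x : Node → ℝ} {M : ℝ} (hM : 0 ≤ M)
    (h : ∑ S ∈ F.1, (∑ α ∈ S, x α) ^ 2 ≤ M ^ 2) : familyNorm F x ≤ M := by
  rw [familyNorm, Real.sqrt_le_left hM]
  exact h

lemma mem_jtSubmodule {x : Node → ℝ} {M : ℝ} (hM : 0 ≤ M)
    (h : ∀ F : SegmentFamily, ∑ S ∈ F.1, (∑ α ∈ S, x α) ^ 2 ≤ M ^ 2) : x ∈ jtSubmodule := by
  refine ⟨M, ?_⟩
  rintro _ ⟨F, rfl⟩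
  exact familyNorm_le_of_sum_sq_le hM (h F)

lemma norm_le {x : JT} {M : ℝ} (hM : 0 ≤ M)
    (h : ∀ F : SegmentFamily, ∑ S ∈ F.1, (∑ α ∈ S, x.coeff α) ^ 2 ≤ M ^ 2) : ‖x‖ ≤ M :=
  ciSup_le fun F => familyNorm_le_of_sum_sq_le hM (h F)

lemma SegmentFamily.sum_sq_le (F : SegmentFamily) (x : JT) :
    ∑ S ∈ F.1, (∑ α ∈ S, x.coeff α) ^ 2 ≤ ‖x‖ ^ 2 :=
  sum_sq_le_norm_sq F.1 id (fun S hS => (F.2.1 S hS).isInterval) F.2.2 x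

lemma exists_family_lt (x : JT) {δ : ℝ} (hδ : 0 < δ) :
    ∃ F : SegmentFamily, ‖x‖ ^ 2 - δ < ∑ S ∈ F.1, (∑ α ∈ S, x.coeff α) ^ 2 := by
  rcases (norm_nonneg x).eq_or_lt with h0 | h0
  · refine ⟨Classical.arbitrary _, ?_⟩
    rw [← h0]
    have : 0 ≤ ∑ S ∈ (Classical.arbitrary SegmentFamily).1, (∑ α ∈ S, x.coeff α) ^ 2 :=
      Finset.sum_nonneg fun _ _ => sq_nonneg _
    linarith
  · have h1 : √(‖x‖ ^ 2 - δ) < ⨆ F : SegmentFamily, familyNorm F x.coeff := by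
      rw [← norm_def, Real.sqrt_lt' h0]
      linarith
    obtain ⟨F, hF⟩ := exists_lt_of_lt_ciSup h1
    refine ⟨F, ?_⟩
    by_contra h
    push Not at h
    exact absurd (Real.sqrt_le_sqrt h) (not_le.2 hF)

/-- Far out in the tree, the norm of `x` is small. -/
lemma exists_level_sum_sq_le (x : JT) {δ : ℝ} (hδ : 0 < δ) :
    ∃ K : ℕ, ∀ {ι : Type} (s : Finset ι) (S : ι → Finset Node),
      (∀ i ∈ s, IsInterval (S i)) → (s : Set ι).PairwiseDisjoint S →
      (∀ i ∈ s, ∀ α ∈ S i, K ≤ α.length) → ∑ i ∈ s, (∑ α ∈ S i, x.coeff α) ^ 2 ≤ δ := by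
  classical
  obtain ⟨F, hF⟩ := exists_family_lt x hδ
  -- `F` already captures ‖x‖² up to δ. Intervals beyond all its levels are disjoint from it, so
  -- adjoining them can gain at most δ.
  refine ⟨(F.1.sup fun S => S.sup List.length) + 1, fun {ι} s S hS hd hK => ?_⟩
  have hlen : ∀ T ∈ F.1, ∀ α ∈ T, α.length ≤ F.1.sup fun S => S.sup List.length := by
    intro T hT α hα
    exact (Finset.le_sup (f := List.length) hα).trans
      (Finset.le_sup (f := fun S : Finset Node => S.sup List.length) hT)
  have h := sum_sq_le_norm_sq (F.1.disjSum s) (Sum.elim id S) ?_ ?_ x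
  · rw [Finset.sum_disjSum] at h
    simp only [Sum.elim_inl, Sum.elim_inr, id] at h
    linarith
  · rintro (T | i) hi
    · exact (F.2.1 T (by simpa using hi)).isInterval
    · exact hS i (by simpa using hi)
  · have key : ∀ T ∈ F.1, ∀ i ∈ s, Disjoint T (S i) := by
      intro T hT i hi
      rw [Finset.disjoint_left]
      intro α h1 h2
      have := hlen T hT α h1
      have := hK i hi α h2
      omega
    rintro (T | i) hi (T' | j) hj hne
    · exact F.2.2 (by simpa using hi) (by simpa using hj) (fun h : T = T' => hne (by rw [h]))
    · exact key T (by simpa using hi) j (by simpa using hj)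
    · exact (key T' (by simpa using hj) i (by simpa using hi)).symm
    · exact hd (by simpa using hi) (by simpa using hj) (fun h : i = j => hne (by rw [h]))

/-! ### Coordinate functionals and restrictions -/

/-- The coordinate functional at a node. -/
def coeffL (α : Node) : JT →L[ℝ] ℝ :=
  LinearMap.mkContinuous
    { toFun := fun x => x.coeff α
      map_add' := fun _ _ => rfl
      map_smul' := fun _ _ => rfl } 1 fun x => by
    rw [one_mul]
    exact abs_coeff_le_norm x α

@[simp] lemma coeffL_apply (α : Node) (x : JT) : coeffL α x = x.coeff α := rfl

/-- The functional `x ↦ ∑_{α ∈ S} x_α`. -/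
def sumL (S : Finset Node) : JT →L[ℝ] ℝ := ∑ α ∈ S, coeffL α

@[simp] lemma sumL_apply (S : Finset Node) (x : JT) : sumL S x = ∑ α ∈ S, x.coeff α := by
  simp [sumL]

lemma coeff_sum {ι : Type*} (s : Finset ι) (x : ι → JT) (α : Node) :
    (∑ i ∈ s, x i).coeff α = ∑ i ∈ s, (x i).coeff α := map_sum (coeffL α) x s

lemma coeff_nodeVec (α β : Node) : (nodeVec α).coeff β = if β = α then 1 else 0 := by
  simp only [nodeVec, coeff, mk, Pi.single_apply]

lemma norm_nodeVec_le (α : Node) : ‖nodeVec α‖ ≤ 1 := by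
  classical
  refine norm_le zero_le_one fun F => ?_
  have h1 : ∀ S : Finset Node, (∑ β ∈ S, (nodeVec α).coeff β) ^ 2 = if α ∈ S then 1 else 0 := by
    intro S
    simp [coeff_nodeVec]
  simp only [h1]
  rw [← Finset.sum_filter]
  have : (F.1.filter fun S => α ∈ S).card ≤ 1 := by
    rw [Finset.card_le_one]
    intro S hS1 T hT1
    rw [Finset.mem_filter] at hS1 hT1
    by_contra hne
    exact Finset.disjoint_left.mp (F.2.2 hS1.1 hT1.1 hne) hS1.2 hT1.2
  simpa using this

open Classical in
lemma sum_sq_filter_le {A : Set Node} (hA : IsOrdConvex A) (F : SegmentFamily) (x : JT) :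
    ∑ S ∈ F.1, (∑ α ∈ S, if α ∈ A then x.coeff α else 0) ^ 2 ≤ ‖x‖ ^ 2 := by
  simp only [← Finset.sum_filter]
  refine sum_sq_le_norm_sq F.1 (fun S => S.filter (· ∈ A))
    (fun S hS => (F.2.1 S hS).isInterval.filter hA) (fun S hS T hT hne => ?_) x
  exact Finset.disjoint_filter_filter (F.2.2 hS hT hne)

open Classical in
/-- The projection of `JT` that restricts the coefficients to an order-convex set of nodes. -/
def restrict (A : Set Node) (hA : IsOrdConvex A) : JT →L[ℝ] JT :=
  LinearMap.mkContinuous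
    { toFun := fun x => mk (fun α => if α ∈ A then x.coeff α else 0)
        (mem_jtSubmodule (norm_nonneg x) fun F => sum_sq_filter_le hA F x)
      map_add' := fun x y => ext_coeff fun α => by
        by_cases h : α ∈ A <;> simp [coeff_add, coeff_mk, h]
      map_smul' := fun c x => ext_coeff fun α => by
        by_cases h : α ∈ A <;> simp [coeff_smul, coeff_mk, h] } 1 fun x => by
    rw [one_mul]
    exact norm_le (norm_nonneg x) fun F => sum_sq_filter_le hA F x

open Classical in
lemma coeff_restrict {A : Set Node} (hA : IsOrdConvex A) (x : JT) (α : Node) :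
    (restrict A hA x).coeff α = if α ∈ A then x.coeff α else 0 := rfl

lemma norm_restrict_le {A : Set Node} (hA : IsOrdConvex A) (x : JT) :
    ‖restrict A hA x‖ ≤ ‖x‖ := by
  classical
  exact norm_le (norm_nonneg x) fun F => sum_sq_filter_le hA F x

lemma restrict_restrict {A B : Set Node} (hA : IsOrdConvex A) (hB : IsOrdConvex B) (h : A ⊆ B)
    (x : JT) : restrict A hA (restrict B hB x) = restrict A hA x := by
  classical
  refine ext_coeff fun α => ?_
  simp only [coeff_restrict]
  by_cases h1 : α ∈ A
  · simp [h1, h h1]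
  · simp [h1]

/-- Lower `2`-estimate for restrictions to disjoint order-convex sets. -/
lemma sum_norm_sq_restrict_le {ι : Type*} (s : Finset ι) (A : ι → Set Node)
    (hA : ∀ i, IsOrdConvex (A i)) (hd : (s : Set ι).PairwiseDisjoint A) (x : JT) :
    ∑ i ∈ s, ‖restrict (A i) (hA i) x‖ ^ 2 ≤ ‖x‖ ^ 2 := by
  classical
  refine le_of_forall_pos_le_add fun δ hδ => ?_
  have hη : 0 < δ / (s.card + 1) := by positivity
  -- Near-optimal families for the pieces, cut down to the sets `A i`, form together one disjoint
  -- family for `x`; the errors add up to at most δ.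
  choose F hF using fun i => exists_family_lt (restrict (A i) (hA i) x) hη
  have h1 := sum_sq_le_norm_sq (s.sigma fun i => (F i).1) (fun p => p.2.filter (· ∈ A p.1))
    (fun p hp => (((F p.1).2.1 p.2 (Finset.mem_sigma.1 hp).2).isInterval.filter (hA p.1))) ?_ x
  · rw [Finset.sum_sigma] at h1
    have h2 : ∀ i ∈ s, ‖restrict (A i) (hA i) x‖ ^ 2 ≤
        ∑ S ∈ (F i).1, (∑ α ∈ S.filter (· ∈ A i), x.coeff α) ^ 2 + δ / (s.card + 1) := by
      intro i _
      have := hF i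
      simp only [coeff_restrict, ← Finset.sum_filter] at this
      linarith
    have h3 := Finset.sum_le_sum h2
    rw [Finset.sum_add_distrib, Finset.sum_const, nsmul_eq_mul] at h3
    have h4 : (s.card : ℝ) * (δ / (s.card + 1)) ≤ δ := by
      rw [mul_div_assoc', div_le_iff₀ (by positivity)]
      nlinarith
    linarith
  · rintro ⟨i, S⟩ hS ⟨j, T⟩ hT hne
    have hS' := Finset.mem_sigma.1 hS
    have hT' := Finset.mem_sigma.1 hT
    rw [Function.onFun, Finset.disjoint_left]
    intro α h1 h2
    rw [Finset.mem_filter] at h1 h2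
    by_cases hij : i = j
    · subst hij
      have hST : S ≠ T := fun h => hne (by rw [h])
      exact Finset.disjoint_left.1 ((F i).2.2 hS'.2 hT'.2 hST) h1.1 h2.1
    · exact Set.disjoint_left.1 (hd hS'.1 hT'.1 hij) h1.2 h2.2

/-- Only segments meeting `A` count, disjointness leaves at most `A.card` of them, and each sum is
at most 2M. All the square-root bounds on sums of node vectors come from here. -/
lemma norm_sq_le_of_card {x : JT} (A : Finset Node) (hx : ∀ α, α ∉ A → x.coeff α = 0) {M : ℝ}
    (hM : ∀ γ, |pathSum γ x.coeff| ≤ M) : ‖x‖ ≤ 2 * M * √A.card := by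
  classical
  have hM0 : 0 ≤ M := (abs_nonneg _).trans (hM [])
  refine norm_le (by positivity) fun F => ?_
  rw [mul_pow, Real.sq_sqrt (by positivity)]
  set G := F.1.filter fun S => (S ∩ A).Nonempty with hG
  have h1 : ∑ S ∈ F.1, (∑ α ∈ S, x.coeff α) ^ 2 = ∑ S ∈ G, (∑ α ∈ S, x.coeff α) ^ 2 := by
    symm
    refine Finset.sum_subset (Finset.filter_subset _ _) fun S hS hSG => ?_
    have : ∀ α ∈ S, x.coeff α = 0 := fun α hα => hx α fun h => hSG
      (Finset.mem_filter.2 ⟨hS, α, Finset.mem_inter.2 ⟨hα, h⟩⟩)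
    rw [Finset.sum_eq_zero this]
    simp
  have h2 : G.card ≤ A.card := by
    have : ∀ S : G, ∃ α, α ∈ S.1 ∩ A := fun S => (Finset.mem_filter.1 S.2).2
    choose f hf using this
    have hinj : Function.Injective f := by
      intro S T hST
      by_contra hne
      have hd := F.2.2 (Finset.mem_filter.1 S.2).1 (Finset.mem_filter.1 T.2).1
        (fun h => hne (Subtype.ext h))
      refine Finset.disjoint_left.1 hd (Finset.mem_inter.1 (hf S)).1 ?_
      rw [hST]
      exact (Finset.mem_inter.1 (hf T)).1
    have := Finset.card_le_card_of_injOn (s := G.attach) (t := A) f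
      (fun S _ => (Finset.mem_inter.1 (hf S)).2) hinj.injOn
    simpa using this
  rw [h1]
  calc _ ≤ ∑ S ∈ G, (2 * M) ^ 2 := by
        refine Finset.sum_le_sum fun S hS => ?_
        exact sq_le_sq' (abs_le.1 ((F.2.1 S (Finset.mem_filter.1 hS).1).abs_sum_le hM)).1
          (abs_le.1 ((F.2.1 S (Finset.mem_filter.1 hS).1).abs_sum_le hM)).2
    _ = G.card * (2 * M) ^ 2 := by simp
    _ ≤ A.card * (2 * M) ^ 2 := by gcongr
    _ = _ := by ring

/-! ### Trunks -/

/-- The nodes of level at least `K`. -/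
def fromLevel (K : ℕ) : Set Node := {α | K ≤ α.length}

lemma isOrdConvex_fromLevel (K : ℕ) : IsOrdConvex (fromLevel K) := fun _ ha _ _ _ hac _ =>
  le_trans ha hac.length_le

lemma isOrdConvex_subtree (n : ℕ) : IsOrdConvex (subtree n) := fun _ _ _ hb _ _ hcb =>
  le_trans (hcb.sublist.count_le true) hb

/-- The interval between α and β lies far out, where single sums are small. Path sums are thus
Cauchy along all branches, uniformly. -/
lemma exists_level_abs_le (x : JT) {δ : ℝ} (hδ : 0 < δ) :
    ∃ K : ℕ, ∀ α β : Node, α <+: β → K ≤ α.length →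
      |pathSum β x.coeff - pathSum α x.coeff| ≤ δ := by
  obtain ⟨K, hK⟩ := exists_level_sum_sq_le x (pow_pos hδ 2)
  refine ⟨K, fun α β hαβ hα => ?_⟩
  have := hK {()} (fun _ => below β \ below α) (fun _ _ => isInterval_below_sdiff α β) (by simp)
    (fun _ _ γ hγ => ?_)
  · rw [Finset.sum_singleton, ← pathSum_sub_pathSum hαβ] at this
    exact abs_le_of_sq_le_sq this hδ.le
  · rw [Finset.mem_sdiff, mem_below, mem_below] at hγ
    rcases List.prefix_or_prefix_of_prefix hγ.1 hαβ with h | h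
    · exact absurd h hγ.2
    · exact hα.trans h.length_le

/-- The node `p 0 ⋯ 0` with `k` appended zeros. -/
def trunkNode (p : Node) (k : ℕ) : Node := p ++ List.replicate k false

@[simp] lemma trunkNode_zero (p : Node) : trunkNode p 0 = p := by simp [trunkNode]

@[simp] lemma length_trunkNode (p : Node) (k : ℕ) : (trunkNode p k).length = p.length + k := by
  simp [trunkNode]

@[simp] lemma count_trunkNode (p : Node) (k : ℕ) :
    (trunkNode p k).count true = p.count true := by
  simp [trunkNode, List.count_replicate]

lemma trunkNode_add (p : Node) (k l : ℕ) : trunkNode p (k + l) = trunkNode (trunkNode p k) l := by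
  rw [trunkNode, List.replicate_add, ← List.append_assoc]
  rfl

lemma trunkNode_succ (p : Node) (k : ℕ) : trunkNode p (k + 1) = trunkNode p k ++ [false] := by
  rw [trunkNode_add]
  rfl

lemma trunkNode_prefix (p : Node) {k l : ℕ} (h : k ≤ l) : trunkNode p k <+: trunkNode p l := by
  obtain ⟨m, rfl⟩ := Nat.exists_eq_add_of_le h
  rw [trunkNode_add]
  exact List.prefix_append _ _

lemma prefix_trunkNode (p : Node) (k : ℕ) : p <+: trunkNode p k := List.prefix_append _ _

lemma trunkNode_injective (p : Node) : Function.Injective (trunkNode p) := fun k l h => by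
  have := congrArg List.length h
  simpa using this

lemma trunkNode_mem_subtree {p : Node} {n : ℕ} (hp : p ∈ subtree n) (k : ℕ) :
    trunkNode p k ∈ subtree n := by
  simpa [subtree] using hp

/-- The path sum as a continuous functional. -/
def pathSumL (γ : Node) : JT →L[ℝ] ℝ := sumL (below γ)

@[simp] lemma pathSumL_apply (γ : Node) (x : JT) : pathSumL γ x = pathSum γ x.coeff := by
  simp [pathSumL, pathSum]

lemma abs_pathSum_le (γ : Node) (x : JT) : |pathSum γ x.coeff| ≤ ‖x‖ :=
  abs_sum_le_norm (isInterval_below γ) x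

lemma exists_tendsto_pathSum (p : Node) (x : JT) :
    ∃ a, Filter.Tendsto (fun k => pathSum (trunkNode p k) x.coeff) Filter.atTop (nhds a) := by
  apply cauchySeq_tendsto_of_complete
  refine Metric.cauchySeq_iff'.2 fun ε hε => ?_
  obtain ⟨K, hK⟩ := exists_level_abs_le x (half_pos hε)
  refine ⟨K, fun k hk => ?_⟩
  rw [Real.dist_eq]
  exact (hK _ _ (trunkNode_prefix p hk) (by simp)).trans_lt (half_lt_self hε)

/-- The functional that sums the coefficients along the infinite branch `p 0 0 0 ⋯`. -/
def branchL (p : Node) : JT →L[ℝ] ℝ :=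
  continuousLinearMapOfTendsto (fun k => pathSumL (trunkNode p k))
    (f := fun x => (exists_tendsto_pathSum p x).choose) (l := Filter.atTop) <| by
      rw [tendsto_pi_nhds]
      intro x
      simpa using (exists_tendsto_pathSum p x).choose_spec

lemma tendsto_branchL (p : Node) (x : JT) :
    Filter.Tendsto (fun k => pathSum (trunkNode p k) x.coeff) Filter.atTop
      (nhds (branchL p x)) :=
  (exists_tendsto_pathSum p x).choose_spec

/-! ### The subspaces `X_n` -/

lemma nodeVec_mem_X {n : ℕ} {α : Node} (h : α ∈ subtree n) : nodeVec α ∈ X n :=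
  Submodule.le_topologicalClosure _ (Submodule.subset_span ⟨α, h, rfl⟩)

lemma finite_level (K : ℕ) : {α : Node | α.length < K}.Finite := List.finite_length_lt _ _

lemma eq_sum_nodeVec {x : JT} (A : Finset Node) (hx : ∀ α, α ∉ A → x.coeff α = 0) :
    x = ∑ α ∈ A, x.coeff α • nodeVec α := by
  refine ext_coeff fun β => ?_
  rw [coeff_sum]
  simp only [coeff_smul, Pi.smul_apply, coeff_nodeVec, smul_eq_mul, mul_ite, mul_one, mul_zero]
  rw [Finset.sum_ite_eq]
  split_ifs with h
  · rfl
  · exact hx β h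

/-- For the converse, cutting `x` at a high level leaves a finite combination of node vectors of
T_n, and the part removed has small norm. -/
lemma mem_X_iff {n : ℕ} {x : JT} : x ∈ X n ↔ ∀ α, α ∉ subtree n → x.coeff α = 0 := by
  classical
  constructor
  · intro hx α hα
    have hle : X n ≤ (coeffL α).ker := by
      refine Submodule.topologicalClosure_minimal _ ?_ (coeffL α).isClosed_ker
      rw [Submodule.span_le]
      rintro _ ⟨β, hβ, rfl⟩
      have : α ≠ β := fun h => hα (h ▸ hβ)
      simp [coeff_nodeVec, this]
    exact hle hx
  · intro hx
    have hcl : x ∈ closure (X n : Set JT) := by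
      refine Metric.mem_closure_iff.2 fun ε hε => ?_
      obtain ⟨K, hK⟩ := exists_level_sum_sq_le x (pow_pos (half_pos hε) 2)
      set y := x - restrict _ (isOrdConvex_fromLevel K) x with hy
      have hyc : ∀ α, y.coeff α = if K ≤ α.length then 0 else x.coeff α := by
        intro α
        rw [hy, coeff_sub, Pi.sub_apply, coeff_restrict]
        by_cases h : K ≤ α.length <;> simp [fromLevel, h]
      refine ⟨y, ?_, ?_⟩
      · rw [eq_sum_nodeVec (x := y) (finite_level K).toFinset fun α hα => by
          rw [hyc, if_pos (by simpa using hα)]]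
        refine Submodule.sum_mem _ fun α _ => ?_
        by_cases h : α ∈ subtree n
        · exact Submodule.smul_mem _ _ (nodeVec_mem_X h)
        · rw [hyc, hx α h, ite_self, zero_smul]
          exact Submodule.zero_mem _
      · rw [dist_eq_norm, hy, sub_sub_cancel]
        refine lt_of_le_of_lt (norm_le (half_pos hε).le fun F => ?_) (half_lt_self hε)
        simp only [coeff_restrict, ← Finset.sum_filter]
        refine hK F.1 _ (fun S hS => (F.2.1 S hS).isInterval.filter (isOrdConvex_fromLevel K))
          (fun S hS T hT hne => Finset.disjoint_filter_filter (F.2.2 hS hT hne))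
          fun S _ α hα => (Finset.mem_filter.1 hα).2
    exact (Submodule.isClosed_topologicalClosure _).closure_subset hcl

end JT

/-! ### Weakly null families -/

section WeaklyNull

variable {ι E : Type*} [NormedAddCommGroup E] [NormedSpace ℝ E]

/-- N indices in this set would give Nδ ≤ ‖φ‖K√N, which bounds N. -/
lemma finite_setOf_le_of_norm_sum_le {x : ι → E} {K : ℝ}
    (h : ∀ s : Finset ι, ‖∑ i ∈ s, x i‖ ≤ K * √s.card) (φ : E →L[ℝ] ℝ) {δ : ℝ} (hδ : 0 < δ) :
    {i | δ ≤ φ (x i)}.Finite := by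
  by_contra hinf
  obtain ⟨N, hN⟩ := exists_nat_gt ((‖φ‖ * K / δ) ^ 2)
  obtain ⟨s, hs, hcard⟩ := Set.Infinite.exists_subset_card_eq hinf N
  have h1 : N * δ ≤ φ (∑ i ∈ s, x i) := by
    rw [map_sum, ← hcard, ← nsmul_eq_mul]
    exact Finset.card_nsmul_le_sum _ _ _ fun i hi => hs hi
  have h2 : φ (∑ i ∈ s, x i) ≤ ‖φ‖ * (K * √N) := by
    rw [← hcard]
    exact (le_abs_self _).trans ((φ.le_opNorm _).trans
      (mul_le_mul_of_nonneg_left (h s) (norm_nonneg _)))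
  have hN0 : (0 : ℝ) < N := (sq_nonneg _).trans_lt hN
  have h3 : √(N : ℝ) * √N = N := Real.mul_self_sqrt hN0.le
  have h4 : ‖φ‖ * K / δ < √N := Real.lt_sqrt_of_sq_lt hN
  rw [div_lt_iff₀ hδ] at h4
  have h5 : 0 < √(N : ℝ) := Real.sqrt_pos.2 hN0
  nlinarith

lemma tendsto_cofinite_of_norm_sum_le {x : ι → E} {K : ℝ}
    (h : ∀ s : Finset ι, ‖∑ i ∈ s, x i‖ ≤ K * √s.card) (φ : E →L[ℝ] ℝ) :
    Filter.Tendsto (fun i => φ (x i)) Filter.cofinite (nhds 0) := by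
  rw [Metric.tendsto_nhds]
  intro δ hδ
  rw [Filter.eventually_cofinite]
  refine ((finite_setOf_le_of_norm_sum_le h φ hδ).union
    (finite_setOf_le_of_norm_sum_le h (-φ) hδ)).subset fun i hi => ?_
  simp only [Set.mem_ofPred_eq, Real.dist_eq, sub_zero, not_lt] at hi
  rcases le_abs.1 hi with h1 | h1
  · exact Or.inl h1
  · exact Or.inr h1

end WeaklyNull

namespace JT

/-! ### Differences of consecutive nodes -/

lemma pathSum_nodeVec (γ α : Node) :
    pathSum γ (nodeVec α).coeff = if α <+: γ then 1 else 0 := by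
  simp [pathSum, coeff_nodeVec]

/-- The difference of the node vectors of `α` and `α0`. -/
def nodeDiff (α : Node) : JT := nodeVec α - nodeVec (α ++ [false])

lemma prefix_append_singleton_cases {α γ : Node} (h : α <+: γ) :
    α = γ ∨ α ++ [false] <+: γ ∨ α ++ [true] <+: γ := by
  obtain ⟨t, rfl⟩ := h
  rcases t with _ | ⟨b, t⟩
  · simp
  · right
    cases b
    · left
      exact ⟨t, by simp⟩
    · right
      exact ⟨t, by simp⟩

lemma not_prefix_false_of_prefix_true {α γ : Node} (h : α ++ [true] <+: γ) :
    ¬ α ++ [false] <+: γ := by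
  intro h'
  have := List.prefix_of_prefix_length_le h h' (by simp)
  have := this.eq_of_length (by simp)
  simp at this

lemma count_lt_of_append_true_prefix {α β : Node} (h : α ++ [true] <+: β) :
    α.count true < β.count true := by
  have := h.sublist.count_le true
  simp at this
  omega

lemma pathSum_nodeDiff (γ α : Node) :
    pathSum γ (nodeDiff α).coeff = if α <+: γ ∧ ¬ α ++ [false] <+: γ then 1 else 0 := by
  have h1 := map_sub (pathSumL γ) (nodeVec α) (nodeVec (α ++ [false]))
  simp only [pathSumL_apply, pathSum_nodeVec] at h1
  rw [nodeDiff, h1]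
  by_cases h : α ++ [false] <+: γ
  · have h2 : α <+: γ := (List.prefix_append _ _).trans h
    simp [h, h2]
  · simp [h]

/-- A path sees `nodeDiff α` only if it ends at α or continues through α1. Nodes of the second kind
have distinct numbers of ones, from 0 to n; the value n + 1 of the injection is reserved for the
endpoint. -/
lemma abs_pathSum_sum_nodeDiff_le {n : ℕ} {s : Finset Node} (hs : ∀ α ∈ s, α ∈ subtree n)
    (γ : Node) : |pathSum γ (∑ α ∈ s, nodeDiff α).coeff| ≤ n + 2 := by
  have h1 := map_sum (pathSumL γ) nodeDiff s
  simp only [pathSumL_apply, pathSum_nodeDiff] at h1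
  rw [h1, Finset.sum_boole, Nat.abs_cast]
  have h2 : (s.filter fun α => α <+: γ ∧ ¬ α ++ [false] <+: γ).card ≤ (Finset.range (n + 2)).card := by
    refine Finset.card_le_card_of_injOn (fun α => if α = γ then n + 1 else α.count true) ?_ ?_
    · intro α hα
      have := hs α (Finset.mem_filter.1 hα).1
      simp only [subtree, Set.mem_ofPred_eq] at this
      simp only [Finset.coe_range, Set.mem_Iio]
      split_ifs <;> omega
    · have key : ∀ α ∈ s.filter (fun α => α <+: γ ∧ ¬ α ++ [false] <+: γ),
          ∀ β ∈ s.filter (fun α => α <+: γ ∧ ¬ α ++ [false] <+: γ), α <+: β → α ≠ β →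
          α ≠ γ ∧ α.count true < β.count true := by
        intro α hα β hβ hαβ hne
        rw [Finset.mem_filter] at hα hβ
        rcases prefix_append_singleton_cases hαβ with h | h | h
        · exact absurd h hne
        · exact absurd (h.trans hβ.2.1) hα.2.2
        · refine ⟨?_, count_lt_of_append_true_prefix h⟩
          rintro rfl
          exact hne (hαβ.eq_of_length_le hβ.2.1.length_le)
      have hcount : ∀ α ∈ s.filter (fun α => α <+: γ ∧ ¬ α ++ [false] <+: γ),
          α.count true ≤ n := fun α hα => hs α (Finset.mem_filter.1 hα).1
      intro α hα β hβ hαβ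
      by_contra hne
      have hα' := hcount α hα
      have hβ' := hcount β hβ
      rcases List.prefix_or_prefix_of_prefix (Finset.mem_filter.1 hα).2.1
        (Finset.mem_filter.1 hβ).2.1 with h | h
      · obtain ⟨h3, h4⟩ := key α hα β hβ h hne
        simp only [h3, if_false] at hαβ
        split_ifs at hαβ <;> omega
      · obtain ⟨h3, h4⟩ := key β hβ α hα h (Ne.symm hne)
        simp only [h3, if_false] at hαβ
        split_ifs at hαβ <;> omega
  rw [Finset.card_range] at h2
  exact_mod_cast h2

lemma norm_sum_nodeDiff_le {n : ℕ} {s : Finset Node} (hs : ∀ α ∈ s, α ∈ subtree n) :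
    ‖∑ α ∈ s, nodeDiff α‖ ≤ 2 * (n + 2) * √2 * √s.card := by
  classical
  have h1 := norm_sq_le_of_card (x := ∑ α ∈ s, nodeDiff α) (s ∪ s.image (· ++ [false]))
    (fun β hβ => by
      rw [coeff_sum]
      refine Finset.sum_eq_zero fun α hα => ?_
      rw [nodeDiff, coeff_sub, Pi.sub_apply, coeff_nodeVec, coeff_nodeVec, if_neg, if_neg, sub_zero]
      · rintro rfl
        exact hβ (Finset.mem_union_right _ (Finset.mem_image_of_mem _ hα))
      · rintro rfl
        exact hβ (Finset.mem_union_left _ hα)) (abs_pathSum_sum_nodeDiff_le hs)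
  refine h1.trans ?_
  rw [mul_assoc _ √2, ← Real.sqrt_mul zero_le_two]
  gcongr
  have h2 := Finset.card_union_le s (s.image (· ++ [false]))
  have h3 := Finset.card_image_le (s := s) (f := (· ++ [false]))
  have : (s ∪ s.image (· ++ [false])).card ≤ 2 * s.card := by omega
  exact_mod_cast this

/-! ### The lower bound for approximating operators -/

/-- The nodes `a i` are pairwise incomparable, being separated at the nodes `c i`, so a path
contains at most one of them. -/
lemma norm_sum_nodeVec_le {n : ℕ} {a c : ℕ → Node}
    (hc : ∀ i < n, c i ++ [false] <+: a i) (ha : ∀ i < n, ∀ j < n, i < j → c i ++ [true] <+: a j) :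
    ‖∑ i ∈ Finset.range n, nodeVec (a i)‖ ≤ 2 * √n := by
  classical
  have hcomp : ∀ i < n, ∀ j < n, i < j → ∀ γ, a i <+: γ → ¬ a j <+: γ := by
    intro i hi j hj hij γ h1 h2
    exact not_prefix_false_of_prefix_true ((ha i hi j hj hij).trans h2) ((hc i hi).trans h1)
  have h1 := norm_sq_le_of_card (x := ∑ i ∈ Finset.range n, nodeVec (a i))
    ((Finset.range n).image a) (M := 1) (fun β hβ => ?_) (fun γ => ?_)
  · refine h1.trans ?_
    rw [mul_one]
    gcongr
    exact_mod_cast Finset.card_image_le.trans (Finset.card_range n).le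
  · rw [coeff_sum]
    refine Finset.sum_eq_zero fun i hi => ?_
    rw [coeff_nodeVec, if_neg]
    rintro rfl
    exact hβ (Finset.mem_image_of_mem _ hi)
  · have h1 := map_sum (pathSumL γ) (fun i => nodeVec (a i)) (Finset.range n)
    simp only [pathSumL_apply, pathSum_nodeVec] at h1
    rw [h1, Finset.sum_boole, Nat.abs_cast]
    norm_cast
    rw [Finset.card_le_one]
    intro i hi j hj
    rw [Finset.mem_filter, Finset.mem_range] at hi hj
    rcases lt_trichotomy i j with h | h | h
    · exact absurd hj.2 (hcomp i hi.1 j hj.1 h γ hi.2)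
    · exact h
    · exact absurd hi.2 (hcomp j hj.1 i hi.1 h γ hj.2)

/-- The pairs follow one another along a chain. A path sees a pair only if it passes `b i` but not
`c i`, which happens for at most one i. -/
lemma norm_sum_nodeVec_sub_le {n : ℕ} {b c : ℕ → Node} (hbc : ∀ i < n, b i <+: c i)
    (hcb : ∀ i < n, ∀ j < n, i < j → c i <+: b j) :
    ‖∑ i ∈ Finset.range n, (nodeVec (b i) - nodeVec (c i))‖ ≤ 2 * √2 * √n := by
  classical
  have h1 := norm_sq_le_of_card (x := ∑ i ∈ Finset.range n, (nodeVec (b i) - nodeVec (c i)))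
    ((Finset.range n).image b ∪ (Finset.range n).image c) (M := 1) (fun β hβ => ?_) (fun γ => ?_)
  · refine h1.trans ?_
    rw [mul_one, mul_assoc, ← Real.sqrt_mul zero_le_two]
    gcongr
    have h2 := Finset.card_union_le ((Finset.range n).image b) ((Finset.range n).image c)
    have h3 := Finset.card_image_le (s := Finset.range n) (f := b)
    have h4 := Finset.card_image_le (s := Finset.range n) (f := c)
    rw [Finset.card_range] at h3 h4
    have : ((Finset.range n).image b ∪ (Finset.range n).image c).card ≤ 2 * n := by omega
    exact_mod_cast this
  · rw [coeff_sum]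
    refine Finset.sum_eq_zero fun i hi => ?_
    rw [coeff_sub, Pi.sub_apply, coeff_nodeVec, coeff_nodeVec, if_neg, if_neg, sub_zero]
    · rintro rfl
      exact hβ (Finset.mem_union_right _ (Finset.mem_image_of_mem _ hi))
    · rintro rfl
      exact hβ (Finset.mem_union_left _ (Finset.mem_image_of_mem _ hi))
  · have h1 := map_sum (pathSumL γ) (fun i => nodeVec (b i) - nodeVec (c i)) (Finset.range n)
    simp only [map_sub, pathSumL_apply, pathSum_nodeVec] at h1
    have h2 : ∀ i ∈ Finset.range n, ((if b i <+: γ then 1 else 0) - (if c i <+: γ then 1 else 0) : ℝ)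
        = if b i <+: γ ∧ ¬ c i <+: γ then 1 else 0 := by
      intro i hi
      by_cases h : c i <+: γ
      · simp [h, (hbc i (Finset.mem_range.1 hi)).trans h]
      · simp [h]
    rw [h1, Finset.sum_congr rfl h2, Finset.sum_boole, Nat.abs_cast]
    norm_cast
    rw [Finset.card_le_one]
    intro i hi j hj
    rw [Finset.mem_filter, Finset.mem_range] at hi hj
    rcases lt_trichotomy i j with h | h | h
    · exact absurd ((hcb i hi.1 j hj.1 h).trans hj.2.1) hi.2.2
    · exact h
    · exact absurd ((hcb j hj.1 i hi.1 h).trans hi.2.1) hj.2.2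

/-- Beyond a late node of the branch `p 0 0 0 ⋯`, the path sums of `u` are close to the sum along
the branch. -/
lemma exists_abs_pathSum_sub_branchL_le (p : Node) (u : JT) {δ : ℝ} (hδ : 0 < δ) :
    ∃ L, ∀ l ≥ L, ∀ γ, trunkNode p l <+: γ → |pathSum γ u.coeff - branchL p u| ≤ 2 * δ := by
  obtain ⟨K, hK⟩ := exists_level_abs_le u hδ
  obtain ⟨L, hL⟩ := Metric.tendsto_atTop.1 (tendsto_branchL p u) δ hδ
  refine ⟨max K L, fun l hl γ hγ => ?_⟩
  have h1 := hK _ _ hγ (by simp; omega)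
  have h2 := hL l (le_trans (le_max_right _ _) hl)
  rw [Real.dist_eq] at h2
  have := abs_sub_le (pathSum γ u.coeff) (pathSum (trunkNode p l) u.coeff) (branchL p u)
  linarith

/-- Hypothesis `hc` is what remains of weak compactness: the images of the nodes of a trunk cluster
weakly at some `v`. Hence `T` nearly kills differences of an early and a late node along the chosen
path. Adding such differences to the vectors `nodeDiff (c i)` keeps the path sums of the images
large but reduces the norm of the sum to O(√n). -/
theorem le_norm_of_approximates (T : JT →L[ℝ] JT) (n : ℕ)
    (hd : ∀ α ∈ subtree n, ‖T (nodeDiff α) - nodeDiff α‖ ≤ 1 / 4)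
    (hc : ∀ p ∈ subtree n, ∃ v : JT, ∀ ψ : JT →L[ℝ] ℝ, ∀ δ > 0, ∀ m : ℕ, ∃ k ≥ m,
      |ψ (T (nodeVec (trunkNode p k)) - v)| ≤ δ) :
    (n : ℝ) / 2 ≤ ‖T‖ * (7 * √n) := by
  classical
  choose! v hv using hc
  -- The path is not known yet, so `k` is chosen through the branch functional, and `l` so late that
  -- every path through that node nearly has the branch sum. The errors are 1/16 + 2 · 1/32 = 1/8.
  have hkl : ∀ p ∈ subtree n, ∃ k l, k ≤ l ∧ ∀ γ, trunkNode p l <+: γ →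
      |pathSumL γ (T (nodeVec (trunkNode p k)) - v p)| ≤ 1 / 8 := by
    intro p hp
    obtain ⟨k, -, hk⟩ := hv p hp (branchL p) (1 / 16) (by norm_num) 0
    obtain ⟨L, hL⟩ := exists_abs_pathSum_sub_branchL_le p (T (nodeVec (trunkNode p k)) - v p)
      (δ := 1 / 32) (by norm_num)
    refine ⟨k, max k L, le_max_left _ _, fun γ hγ => ?_⟩
    have h1 := hL _ (le_max_right k L) γ hγ
    rw [pathSumL_apply]
    have := abs_sub_abs_le_abs_sub (pathSum γ (T (nodeVec (trunkNode p k)) - v p).coeff)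
      (branchL p (T (nodeVec (trunkNode p k)) - v p))
    linarith
  choose! k l hkl hl using hkl
  -- the starting points of the successive trunks
  let p : ℕ → Node := fun i => Nat.rec [] (fun _ q => trunkNode q (l q) ++ [true]) i
  have hp1 : ∀ i, p (i + 1) = trunkNode (p i) (l (p i)) ++ [true] := fun _ => rfl
  have hcount : ∀ i, (p i).count true = i := by
    intro i
    induction i with
    | zero => rfl
    | succ i ih => rw [hp1, List.count_append, count_trunkNode, ih]; simp
  have hpT : ∀ i < n, p i ∈ subtree n := fun i hi => by
    simp only [subtree, Set.mem_ofPred_eq, hcount]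
    omega
  have hpm : ∀ i j, i ≤ j → p i <+: p j := by
    intro i j hij
    induction hij with
    | refl => exact List.prefix_rfl
    | step _ ih =>
      refine ih.trans ?_
      rw [Nat.succ_eq_add_one, hp1]
      exact (prefix_trunkNode _ _).trans (List.prefix_append _ _)
  set c : ℕ → Node := fun i => trunkNode (p i) (l (p i)) with hcdef
  set b : ℕ → Node := fun i => trunkNode (p i) (k (p i)) with hbdef
  have hc1 : ∀ i j, i < j → c i ++ [true] <+: p j := fun i j hij => hpm (i + 1) j hij
  have hcT : ∀ i < n, c i ∈ subtree n := fun i hi => trunkNode_mem_subtree (hpT i hi) _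
  -- Now the path to `p n` is fixed and the late nodes can be tested against it directly. The bound
  -- on `m` places `a i` at or beyond `c i ++ [false]`, off that path.
  have hm : ∀ i < n, ∃ m ≥ l (p i) + 1,
      |pathSumL (p n) (T (nodeVec (trunkNode (p i) m)) - v (p i))| ≤ 1 / 8 := fun i hi =>
    hv (p i) (hpT i hi) _ _ (by norm_num) _
  choose! m hml hm using hm
  set a : ℕ → Node := fun i => trunkNode (p i) (m i) with hadef
  have hca : ∀ i < n, c i ++ [false] <+: a i := fun i hi => by
    simp only [hcdef, hadef, ← trunkNode_succ]
    exact trunkNode_prefix _ (hml i hi)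
  -- Grouped for the norm: two antichains and one sequence of consecutive pairs, with constants 2 +
  -- 2 + 2√2 ≤ 7. For the lower bound `h5` regroups each term as f_a - f_b + `nodeDiff (c i)`.
  set x : JT := (∑ i ∈ Finset.range n, nodeVec (a i) -
    ∑ i ∈ Finset.range n, nodeVec (c i ++ [false])) -
    ∑ i ∈ Finset.range n, (nodeVec (b i) - nodeVec (c i)) with hx
  have hxnorm : ‖x‖ ≤ 7 * √n := by
    have h1 := norm_sum_nodeVec_le hca fun i hi j hj hij =>
      (hc1 i j hij).trans (prefix_trunkNode _ _)
    have h2 := norm_sum_nodeVec_le (n := n) (a := fun i => c i ++ [false]) (c := c)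
      (fun i _ => List.prefix_rfl) fun i hi j hj hij =>
      (hc1 i j hij).trans ((prefix_trunkNode _ _).trans (List.prefix_append _ _))
    have h3 := norm_sum_nodeVec_sub_le (n := n) (b := b) (c := c)
      (fun i hi => trunkNode_prefix _ (hkl _ (hpT i hi))) fun i hi j hj hij =>
      ((List.prefix_append _ _).trans (hc1 i j hij)).trans (prefix_trunkNode _ _)
    have h4 : √2 ≤ (3 / 2 : ℝ) := by
      rw [Real.sqrt_le_left (by norm_num)]
      norm_num
    have h5 := norm_sub_le (∑ i ∈ Finset.range n, nodeVec (a i) -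
      ∑ i ∈ Finset.range n, nodeVec (c i ++ [false]))
      (∑ i ∈ Finset.range n, (nodeVec (b i) - nodeVec (c i)))
    have h6 := norm_sub_le (∑ i ∈ Finset.range n, nodeVec (a i))
      (∑ i ∈ Finset.range n, nodeVec (c i ++ [false]))
    have h7 : 2 * √2 * √n ≤ 3 * √n := by
      have := Real.sqrt_nonneg (n : ℝ)
      nlinarith
    linarith
  have hterm : ∀ i ∈ Finset.range n, (1 : ℝ) / 2 ≤
      pathSumL (p n) (T (nodeVec (a i) - nodeVec (c i ++ [false]) -
        (nodeVec (b i) - nodeVec (c i)))) := by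
    intro i hi
    have hi := Finset.mem_range.1 hi
    have h1 := hm i hi
    have h2 := hl (p i) (hpT i hi) (p n) ((List.prefix_append _ _).trans (hc1 i n hi))
    have h3 : |pathSumL (p n) (T (nodeDiff (c i)) - nodeDiff (c i))| ≤ 1 / 4 := by
      rw [pathSumL_apply]
      exact (abs_pathSum_le _ _).trans (hd _ (hcT i hi))
    have h4 : pathSumL (p n) (nodeDiff (c i)) = 1 := by
      rw [pathSumL_apply, pathSum_nodeDiff, if_pos]
      exact ⟨(List.prefix_append _ _).trans (hc1 i n hi),
        not_prefix_false_of_prefix_true (hc1 i n hi)⟩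
    rw [map_sub] at h1 h2 h3
    rw [h4] at h3
    have h5 : nodeVec (a i) - nodeVec (c i ++ [false]) - (nodeVec (b i) - nodeVec (c i)) =
        nodeVec (a i) - nodeVec (b i) + nodeDiff (c i) := by
      rw [nodeDiff]
      abel
    rw [h5, map_add, map_sub, map_add, map_sub]
    simp only [hadef, hbdef]
    -- 1 - 1/4 - 1/8 - 1/8 = 1/2.
    linarith [(abs_le.1 h1).1, (abs_le.1 h2).2, (abs_le.1 h3).1]
  have h1 : (n : ℝ) / 2 ≤ pathSumL (p n) (T x) := by
    rw [hx, ← Finset.sum_sub_distrib, ← Finset.sum_sub_distrib, map_sum, map_sum]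
    refine le_trans (le_of_eq ?_) (Finset.card_nsmul_le_sum _ _ _ hterm)
    rw [Finset.card_range, nsmul_eq_mul]
    ring
  have h2 : pathSumL (p n) (T x) ≤ ‖T x‖ := by
    rw [pathSumL_apply]
    exact (le_abs_self _).trans (abs_pathSum_le _ _)
  exact (h1.trans h2).trans ((T.le_opNorm x).trans
    (mul_le_mul_of_nonneg_left hxnorm (norm_nonneg _)))

end JT

/-! ### Weak compactness -/

section WeakCompactness

variable {E F : Type*} [NormedAddCommGroup E] [NormedSpace ℝ E] [NormedAddCommGroup F]
  [NormedSpace ℝ F]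

lemma continuous_dual_weakSpace (φ : E →L[ℝ] ℝ) :
    Continuous fun w : WeakSpace ℝ E => φ ((toWeakSpace ℝ E).symm w) :=
  WeakBilin.eval_continuous (topDualPairing ℝ E).flip φ

lemma continuous_weakSpace_of_forall {Y : Type*} [TopologicalSpace Y] {g : Y → E}
    (h : ∀ φ : E →L[ℝ] ℝ, Continuous fun y => φ (g y)) :
    Continuous fun y => toWeakSpace ℝ E (g y) :=
  WeakBilin.continuous_of_continuous_eval (topDualPairing ℝ E).flip h

lemma tendsto_weakSpace_of_forall {Y : Type*} {l : Filter Y} {g : Y → E} {x : E}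
    (h : ∀ φ : E →L[ℝ] ℝ, Filter.Tendsto (fun y => φ (g y)) l (nhds (φ x))) :
    Filter.Tendsto (fun y => toWeakSpace ℝ E (g y)) l (nhds (toWeakSpace ℝ E x)) := by
  have hinj : Function.Injective (topDualPairing ℝ E).flip := by
    intro a b hab
    refine sub_eq_zero.1 (SeparatingDual.eq_zero_of_forall_dual_eq_zero (R := ℝ) fun φ => ?_)
    rw [map_sub, sub_eq_zero]
    exact LinearMap.congr_fun hab φ
  exact (WeakBilin.tendsto_iff_forall_eval_tendsto (topDualPairing ℝ E).flip hinj).2 h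

lemma IsWeaklyCompact.image {D : Set E} (hD : IsWeaklyCompact E D) (T : E →L[ℝ] F) :
    IsWeaklyCompact F (T '' D) := by
  have h := IsCompact.image hD (WeakSpace.map T).continuous
  rw [Set.image_image] at h
  rw [IsWeaklyCompact, Set.image_image]
  exact h

/-- A bounded operator whose values on the unit ball lie in a weakly compact set. -/
def MapsBallToWeaklyCompact (T : E →L[ℝ] F) : Prop :=
  ∃ K : Set (WeakSpace ℝ F), IsCompact K ∧ ∀ x, ‖x‖ ≤ 1 → toWeakSpace ℝ F (T x) ∈ K

lemma isWeaklyCompactOperator_iff (T : E →L[ℝ] E) :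
    IsWeaklyCompactOperator E T ↔ MapsBallToWeaklyCompact T := by
  constructor
  · intro h
    refine ⟨_, h, fun x hx => subset_closure ?_⟩
    exact ⟨_, ⟨x, by simpa using hx, rfl⟩, rfl⟩
  · rintro ⟨K, hK, h⟩
    refine hK.closure_of_subset ?_
    rintro _ ⟨_, ⟨x, hx, rfl⟩, rfl⟩
    exact h x (by simpa using hx)

lemma MapsBallToWeaklyCompact.zero : MapsBallToWeaklyCompact (0 : E →L[ℝ] F) :=
  ⟨{0}, isCompact_singleton, fun x _ => by simp⟩

lemma MapsBallToWeaklyCompact.add {S T : E →L[ℝ] F} (hS : MapsBallToWeaklyCompact S)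
    (hT : MapsBallToWeaklyCompact T) : MapsBallToWeaklyCompact (S + T) := by
  obtain ⟨K, hK, hSK⟩ := hS
  obtain ⟨L, hL, hTL⟩ := hT
  refine ⟨_, (hK.prod hL).image continuous_add, fun x hx => ⟨(_, _), ⟨hSK x hx, hTL x hx⟩, ?_⟩⟩
  rw [add_apply, map_add]

lemma MapsBallToWeaklyCompact.sum {ι : Type*} (s : Finset ι) {T : ι → E →L[ℝ] F}
    (h : ∀ i ∈ s, MapsBallToWeaklyCompact (T i)) : MapsBallToWeaklyCompact (∑ i ∈ s, T i) := by
  classical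
  induction s using Finset.induction_on with
  | empty => exact MapsBallToWeaklyCompact.zero
  | insert i s hi ih =>
    rw [Finset.sum_insert hi]
    exact (h i (Finset.mem_insert_self i s)).add
      (ih fun j hj => h j (Finset.mem_insert_of_mem hj))

lemma MapsBallToWeaklyCompact.comp_left {G : Type*} [NormedAddCommGroup G] [NormedSpace ℝ G]
    {T : E →L[ℝ] F} (h : MapsBallToWeaklyCompact T) (S : F →L[ℝ] G) :
    MapsBallToWeaklyCompact (S.comp T) := by
  obtain ⟨K, hK, hTK⟩ := h
  exact ⟨_, hK.image (WeakSpace.map S).continuous, fun x hx => ⟨_, hTK x hx, rfl⟩⟩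

lemma MapsBallToWeaklyCompact.comp_right {G : Type*} [NormedAddCommGroup G] [NormedSpace ℝ G]
    {T : E →L[ℝ] F} (h : MapsBallToWeaklyCompact T) {S : G →L[ℝ] E} (hS : ∀ x, ‖S x‖ ≤ ‖x‖) :
    MapsBallToWeaklyCompact (T.comp S) := by
  obtain ⟨K, hK, hTK⟩ := h
  exact ⟨K, hK, fun x hx => hTK _ ((hS x).trans hx)⟩

/-- Sequences in a relatively weakly compact set have weak cluster points. -/
lemma exists_weak_cluster {K : Set (WeakSpace ℝ E)} (hK : IsCompact K) {u : ℕ → E}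
    (hu : ∀ k, toWeakSpace ℝ E (u k) ∈ K) :
    ∃ v : E, toWeakSpace ℝ E v ∈ K ∧ ∀ (t : Finset (E →L[ℝ] ℝ)) (δ : (E →L[ℝ] ℝ) → ℝ),
      (∀ ψ ∈ t, 0 < δ ψ) → ∀ m : ℕ, ∃ k ≥ m, ∀ ψ ∈ t, |ψ (u k - v)| < δ ψ := by
  obtain ⟨w, hwK, hw⟩ := hK.exists_mapClusterPt (f := Filter.atTop)
    (u := fun k => toWeakSpace ℝ E (u k)) (by simp [hu])
  refine ⟨(toWeakSpace ℝ E).symm w, by simpa using hwK, fun t δ hδ m => ?_⟩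
  have h1 : {z : WeakSpace ℝ E | ∀ ψ ∈ t,
      |ψ ((toWeakSpace ℝ E).symm z) - ψ ((toWeakSpace ℝ E).symm w)| < δ ψ} ∈ nhds w := by
    refine (Filter.eventually_all_finset t).2 fun ψ hψ => ?_
    have := ((continuous_dual_weakSpace ψ).tendsto w).eventually (Metric.ball_mem_nhds _ (hδ ψ hψ))
    simpa [Real.dist_eq] using this
  obtain ⟨k, hk, hk'⟩ := Filter.frequently_atTop.1 (hw.frequently h1) m
  refine ⟨k, hk, fun ψ hψ => ?_⟩
  rw [map_sub]
  simpa using hk' ψ hψ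

/-- A pointwise absolutely summable family of functionals, with sums bounded by the norm, has a
sum in the dual. -/
lemma exists_hasSum_dual (ψ : ℕ → E →L[ℝ] ℝ)
    (hψ : ∀ y J, ∑ j ∈ Finset.range J, |ψ j y| ≤ ‖y‖) :
    ∃ Φ : E →L[ℝ] ℝ, ∀ y, HasSum (fun j => ψ j y) (Φ y) := by
  have hsa : ∀ y, Summable fun j => |ψ j y| := fun y =>
    summable_of_sum_range_le (fun _ => abs_nonneg _) (hψ y)
  have hs : ∀ y, Summable fun j => ψ j y := fun y => (hsa y).of_abs
  let L : E →ₗ[ℝ] ℝ :=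
    { toFun := fun y => ∑' j, ψ j y
      map_add' := fun y z => by
        rw [← (hs y).tsum_add (hs z)]
        exact tsum_congr fun j => map_add _ _ _
      map_smul' := fun c y => by
        rw [RingHom.id_apply, smul_eq_mul, ← tsum_mul_left]
        exact tsum_congr fun j => map_smul _ _ _ }
  have hL : ∀ y, ‖L y‖ ≤ 1 * ‖y‖ := fun y => by
    rw [one_mul]
    have h1 : HasSum (fun j => ψ j y) (L y) := (hs y).hasSum
    exact le_of_tendsto h1.tendsto_sum_nat.norm (Filter.Eventually.of_forall fun J =>
      (Finset.abs_sum_le_sum_abs _ _).trans (hψ y J))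
  exact ⟨L.mkContinuous 1 hL, fun y => (hs y).hasSum⟩

/-! ### Uniform tails of weakly compact sets in ℓ¹-type sums -/

section Tail

variable {G : ℕ → Type*} [∀ i, NormedAddCommGroup (G i)] [∀ i, NormedSpace ℝ (G i)]
  {P : ∀ i, E →L[ℝ] G i}

lemma exists_tail_le (hP : ∀ x N, ∑ i ∈ Finset.range N, ‖P i x‖ ≤ ‖x‖) (x : E) {δ : ℝ}
    (hδ : 0 < δ) : ∃ N, ∀ k ≥ N, ∀ M, ∑ i ∈ Finset.Ico k M, ‖P i x‖ ≤ δ := by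
  have hsum : Summable fun i => ‖P i x‖ :=
    summable_of_sum_range_le (fun _ => norm_nonneg _) (hP x)
  obtain ⟨s, hs⟩ := summable_iff_vanishing_norm.1 hsum δ hδ
  refine ⟨s.sup id + 1, fun k hk M => (le_abs_self _).trans (hs _ ?_).le⟩
  rw [Finset.disjoint_left]
  intro i hi his
  have := Finset.le_sup (f := id) his
  have := (Finset.mem_Ico.1 hi).1
  simp only [id] at *
  omega

/-- Gliding hump: a sequence without uniformly small tails carries functionals on successive
blocks that are large on a subsequence. -/
lemma exists_gliding_hump (hP : ∀ x N, ∑ i ∈ Finset.range N, ‖P i x‖ ≤ ‖x‖) {ε : ℝ} (hε : 0 < ε)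
    {x : ℕ → E} {v : E} (hx : ∀ N, ∃ M, ε < ∑ i ∈ Finset.Ico N M, ‖P i (x N)‖)
    (hv : ∀ (t : Finset (E →L[ℝ] ℝ)) (δ : (E →L[ℝ] ℝ) → ℝ),
      (∀ ψ ∈ t, 0 < δ ψ) → ∀ m : ℕ, ∃ k ≥ m, ∀ ψ ∈ t, |ψ (x k - v)| < δ ψ) :
    ∃ (κ μ : ℕ → ℕ) (ψ : ℕ → E →L[ℝ] ℝ), (∀ j, κ j ≤ μ j) ∧ (∀ i j, i < j → μ i < κ j) ∧
      (∀ j, j + 1 ≤ μ j) ∧ (∀ j y, |ψ j y| ≤ ∑ i ∈ Finset.Ico (κ j) (μ j), ‖P i y‖) ∧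
      (∀ j, 6 / 8 * ε ≤ ψ j (x (κ j) - v)) ∧
      (∀ j L, ∑ i ∈ Finset.Ico (μ j) L, ‖P i (x (κ j) - v)‖ ≤ ε / 8) ∧
      ∀ i j, i < j → |ψ i (x (κ j) - v)| < ε / 8 * (1 / 2) ^ μ i := by
  classical
  choose M hM using hx
  obtain ⟨N₀, hN₀⟩ := exists_tail_le hP v (show 0 < ε / 8 by positivity)
  -- A triple holds the start of a block, its end, and a functional living on it. The start is also
  -- the index of the vector tested.
  let P' : ℕ × ℕ × (E →L[ℝ] ℝ) → Prop := fun q =>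
    q.1 ≤ q.2.1 ∧ 1 ≤ q.2.1 ∧ (∀ y, |q.2.2 y| ≤ ∑ i ∈ Finset.Ico q.1 q.2.1, ‖P i y‖) ∧
      6 / 8 * ε ≤ q.2.2 (x q.1 - v) ∧ ∀ L, ∑ i ∈ Finset.Ico q.2.1 L, ‖P i (x q.1 - v)‖ ≤ ε / 8
  let r : ℕ × ℕ × (E →L[ℝ] ℝ) → ℕ × ℕ × (E →L[ℝ] ℝ) → Prop := fun q q' =>
    q.2.1 < q'.1 ∧ |q.2.2 (x q'.1 - v)| < ε / 8 * (1 / 2) ^ q.2.1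
  obtain ⟨f, hf, hfr⟩ := exists_seq_of_forall_finset_exists P' r (by
    intro s hs
    -- Tolerances depend on the functional alone, so triples sharing a functional get the smallest
    -- of theirs. The value 1 is never attained on the image of `s`.
    obtain ⟨k, hk, hk'⟩ := hv (s.image fun q => q.2.2)
      (fun ψ => if h : (s.filter fun q => q.2.2 = ψ).Nonempty then
        (s.filter fun q => q.2.2 = ψ).inf' h fun q => ε / 8 * (1 / 2) ^ q.2.1 else 1)
      (by
        intro ψ _
        split_ifs with h
        · rw [Finset.lt_inf'_iff]
          intro q _
          positivity
        · exact one_pos)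
      (max (N₀ + 1) (s.sup (fun q => q.2.1) + 1))
    have hkN : N₀ ≤ k := by omega
    obtain ⟨L₀, hL₀⟩ := exists_tail_le hP (x k - v) (show 0 < ε / 8 by positivity)
    set L := max L₀ (max (M k) (k + 1)) with hL
    -- The functional of the block adds up norming functionals of the components, so its value is
    -- the ℓ¹-mass of `x k - v` on the block.
    choose φ hφ1 hφ2 using fun i => exists_dual_vector'' ℝ (P i (x k - v))
    refine ⟨(k, L, ∑ i ∈ Finset.Ico k L, (φ i).comp (P i)), ⟨?_, ?_, ?_, ?_, ?_⟩, ?_⟩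
    · show k ≤ L
      omega
    · show 1 ≤ L
      omega
    · intro y
      simp only [sum_apply, ContinuousLinearMap.comp_apply]
      refine (Finset.abs_sum_le_sum_abs _ _).trans (Finset.sum_le_sum fun i _ => ?_)
      exact ((φ i).le_opNorm _).trans (mul_le_of_le_one_left (norm_nonneg _) (hφ1 i))
    · simp only [sum_apply, ContinuousLinearMap.comp_apply, hφ2]
      have h1 : ε ≤ ∑ i ∈ Finset.Ico k L, ‖P i (x k)‖ :=
        (hM k).le.trans (Finset.sum_le_sum_of_subset_of_nonneg
          (Finset.Ico_subset_Ico_right (by omega)) fun _ _ _ => norm_nonneg _)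
      have h2 := hN₀ k hkN L
      have h3 : ∑ i ∈ Finset.Ico k L, ‖P i (x k)‖ ≤
          ∑ i ∈ Finset.Ico k L, ‖P i (x k - v)‖ + ∑ i ∈ Finset.Ico k L, ‖P i v‖ := by
        rw [← Finset.sum_add_distrib]
        refine Finset.sum_le_sum fun i _ => ?_
        rw [map_sub]
        linarith [norm_sub_norm_le (P i (x k)) (P i v)]
      simp only [RCLike.ofReal_real_eq_id, id]
      linarith
    · exact hL₀ L (le_max_left _ _)
    · intro q hq
      refine ⟨?_, ?_⟩
      · have := Finset.le_sup (f := fun q : ℕ × ℕ × (E →L[ℝ] ℝ) => q.2.1) hq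
        show q.2.1 < k
        omega
      · refine (hk' q.2.2 (Finset.mem_image_of_mem _ hq)).trans_le ?_
        have hq' : q ∈ s.filter fun q' => q'.2.2 = q.2.2 := Finset.mem_filter.2 ⟨hq, rfl⟩
        rw [dif_pos ⟨q, hq'⟩]
        exact Finset.inf'_le _ hq')
  have hμ1 : ∀ j, j + 1 ≤ (f j).2.1 := by
    intro j
    induction j with
    | zero => exact (hf 0).2.1
    | succ j ih =>
      have h1 : (f j).2.1 < (f (j + 1)).1 := (hfr j (j + 1) (Nat.lt_succ_self j)).1
      have h2 : (f (j + 1)).1 ≤ (f (j + 1)).2.1 := (hf (j + 1)).1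
      omega
  exact ⟨fun j => (f j).1, fun j => (f j).2.1, fun j => (f j).2.2, fun j => (hf j).1,
    fun i j h => (hfr i j h).1, hμ1, fun j => (hf j).2.2.1, fun j => (hf j).2.2.2.1,
    fun j => (hf j).2.2.2.2, fun i j h => (hfr i j h).2⟩

/-- Weakly compact sets have uniformly small tails in `ℓ¹`-sums. -/
lemma IsWeaklyCompact.exists_tail_le {D : Set E} (hD : IsWeaklyCompact E D)
    (hP : ∀ x N, ∑ i ∈ Finset.range N, ‖P i x‖ ≤ ‖x‖) {ε : ℝ} (hε : 0 < ε) :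
    ∃ N, ∀ x ∈ D, ∀ M, ∑ i ∈ Finset.Ico N M, ‖P i x‖ ≤ ε := by
  by_contra hcon
  push Not at hcon
  choose x hxD hM using hcon
  have hxK : ∀ k, toWeakSpace ℝ E (x k) ∈ toWeakSpace ℝ E '' D := fun k => ⟨x k, hxD k, rfl⟩
  obtain ⟨v, -, hv⟩ := exists_weak_cluster hD hxK
  obtain ⟨κ, μ, ψ, hκμ, hμκ, hμ1, hψ, hψx, htail, hψs⟩ := exists_gliding_hump hP hε hM hv
  have hmono : StrictMono κ := strictMono_nat_of_lt_succ fun j =>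
    (hκμ j).trans_lt (hμκ j (j + 1) (Nat.lt_succ_self j))
  have hblock : ∀ y j₀ J, ∑ j ∈ Finset.Ico j₀ J, |ψ j y| ≤
      ∑ i ∈ Finset.Ico (κ j₀) (κ J), ‖P i y‖ := by
    intro y j₀ J
    rcases le_or_gt j₀ J with h | h
    · induction J, h using Nat.le_induction with
      | base => simp
      | succ J hJ ih =>
        rw [Finset.sum_Ico_succ_top hJ, ← Finset.sum_Ico_consecutive _ (hmono.monotone hJ)
          (hmono.monotone (Nat.le_succ J))]
        refine add_le_add ih ((hψ J y).trans ?_)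
        exact Finset.sum_le_sum_of_subset_of_nonneg
          (Finset.Ico_subset_Ico_right (hμκ J (J + 1) (Nat.lt_succ_self J)).le)
          fun _ _ _ => norm_nonneg _
    · rw [Finset.Ico_eq_empty_of_le h.le]
      simp only [Finset.sum_empty]
      exact Finset.sum_nonneg fun _ _ => norm_nonneg _
  have hle : ∀ y J, ∑ j ∈ Finset.range J, |ψ j y| ≤ ‖y‖ := by
    intro y J
    rw [Finset.range_eq_Ico]
    refine (hblock y 0 J).trans (le_trans ?_ (hP y (κ J)))
    rw [Finset.range_eq_Ico]
    exact Finset.sum_le_sum_of_subset_of_nonneg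
      (Finset.Ico_subset_Ico_left (Nat.zero_le _)) fun _ _ _ => norm_nonneg _
  obtain ⟨Φ, hΦ⟩ := exists_hasSum_dual ψ hle
  have hgeo : HasSum (fun j => ε / 8 * (1 / 2) ^ (j + 1) : ℕ → ℝ) (ε / 8) := by
    have := (hasSum_geometric_two' 1).mul_left (ε / 8)
    rw [mul_one] at this
    refine this.congr_fun fun j => ?_
    rw [pow_succ]
    simp only [one_div, inv_pow]
    ring
  have hweight : ∀ j, ε / 8 * (1 / 2 : ℝ) ^ μ j ≤ ε / 8 * (1 / 2) ^ (j + 1) := fun j => by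
    gcongr ?_ * ?_
    exact pow_le_pow_of_le_one (by norm_num) (by norm_num) (hμ1 j)
  -- Functionals with i < j are small by the choice of `κ j`, those with i > j because `x (κ j) - v`
  -- has little mass beyond `μ j`. Each group costs ε/8.
  have hlow : ∀ j, 4 / 8 * ε ≤ Φ (x (κ j) - v) := by
    intro j
    have h1 : ∑ i ∈ Finset.range j, |ψ i (x (κ j) - v)| ≤ ε / 8 := by
      refine le_trans (Finset.sum_le_sum fun i hi => ?_)
        (sum_le_hasSum (Finset.range j) (fun i _ => by positivity) hgeo)
      exact (hψs i j (Finset.mem_range.1 hi)).le.trans (hweight i)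
    have h2 : ∀ J, ∑ i ∈ Finset.Ico (j + 1) J, |ψ i (x (κ j) - v)| ≤ ε / 8 := by
      intro J
      refine (hblock _ _ _).trans (le_trans ?_ (htail j (κ J)))
      exact Finset.sum_le_sum_of_subset_of_nonneg
        (Finset.Ico_subset_Ico_left (hμκ j (j + 1) (Nat.lt_succ_self j)).le)
        fun _ _ _ => norm_nonneg _
    have h3 : 6 / 8 * ε ≤ ψ j (x (κ j) - v) := hψx j
    refine ge_of_tendsto (hΦ (x (κ j) - v)).tendsto_sum_nat
      (Filter.eventually_atTop.2 ⟨j + 1, fun J hJ => ?_⟩)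
    rw [← Finset.sum_range_add_sum_Ico _ hJ, Finset.sum_range_succ]
    have h4 := (Finset.abs_sum_le_sum_abs (fun i => ψ i (x (κ j) - v)) (Finset.range j)).trans h1
    have h5 := (Finset.abs_sum_le_sum_abs (fun i => ψ i (x (κ j) - v))
      (Finset.Ico (j + 1) J)).trans (h2 J)
    linarith [(abs_le.1 h4).1, (abs_le.1 h5).1]
  -- The subsequence need not cluster at `v`, so a cluster point `v'` of its own is taken. Every `ψ
  -- i` is small at `v' - v`, hence so is `Φ`, while `Φ (x (κ j) - v)` stays at least ε/2.
  obtain ⟨v', -, hv'⟩ := exists_weak_cluster hD (u := fun j => x (κ j)) fun j => hxK _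
  have hψv : ∀ i, |ψ i (v' - v)| ≤ ε / 8 * (1 / 2) ^ (i + 1) := by
    intro i
    refine le_of_forall_pos_le_add fun δ hδ => ?_
    obtain ⟨j, hj, hj'⟩ := hv' {ψ i} (fun _ => δ) (by simp [hδ]) (i + 1)
    have h1 := hj' (ψ i) (by simp)
    have h2 := (hψs i j hj).le.trans (hweight i)
    have h3 : ψ i (v' - v) = ψ i (x (κ j) - v) - ψ i (x (κ j) - v') := by
      simp only [map_sub]
      ring
    rw [h3]
    exact (abs_sub _ _).trans (by linarith)
  have hup : Φ (v' - v) ≤ ε / 8 := by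
    exact hasSum_le (fun i => (le_abs_self _).trans (hψv i)) (hΦ _) hgeo
  obtain ⟨j, -, hj⟩ := hv' {Φ} (fun _ => ε / 8) (by simp; positivity) 0
  have h1 := hj Φ (by simp)
  have h2 := hlow j
  rw [map_sub] at h1 h2 hup
  linarith [(abs_lt.1 h1).2]

end Tail

/-- Functionals are bounded on `D`; the uniform boundedness principle applies in the bidual. -/
lemma IsWeaklyCompact.exists_norm_le {D : Set E} (hD : IsWeaklyCompact E D) :
    ∃ M, ∀ x ∈ D, ‖x‖ ≤ M := by
  obtain ⟨C, hC⟩ := banach_steinhaus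
    (g := fun x : D => NormedSpace.inclusionInDoubleDual ℝ E x.1) fun φ => by
      obtain ⟨B, hB⟩ := (IsCompact.image hD (continuous_dual_weakSpace φ)).isBounded.exists_norm_le
      exact ⟨B, fun x => hB _ ⟨_, ⟨x.1, x.2, rfl⟩, rfl⟩⟩
  refine ⟨C, fun x hx => ?_⟩
  have := hC ⟨x, hx⟩
  rwa [show ‖NormedSpace.inclusionInDoubleDual ℝ E x‖ = ‖x‖ from
    (NormedSpace.inclusionInDoubleDualLi ℝ (E := E)).norm_map x] at this

end WeakCompactness

/-! ### Convex combinations of pointwise null sequences -/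

section Mazur

variable {K : Type*} [TopologicalSpace K]

/-- The convex combinations of the functions `h k` with `k ≥ m`. -/
def convexCombinations (h : ℕ → C(K, ℝ)) (m : ℕ) : Set C(K, ℝ) :=
  {f | ∃ (e : ℕ) (c : ℕ → ℝ), (∀ k, 0 ≤ c k) ∧ (∀ k, k ∉ Finset.Ico m e → c k = 0) ∧
    ∑ k ∈ Finset.Ico m e, c k = 1 ∧ f = ∑ k ∈ Finset.Ico m e, c k • h k}

lemma convex_convexCombinations (h : ℕ → C(K, ℝ)) (m : ℕ) :
    Convex ℝ (convexCombinations h m) := by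
  rintro _ ⟨e, c, hc, hce, hc1, rfl⟩ _ ⟨e', c', hc', hce', hc1', rfl⟩ a b ha hb hab
  have h1 : Finset.Ico m e ⊆ Finset.Ico m (max e e') :=
    Finset.Ico_subset_Ico_right (le_max_left _ _)
  have h2 : Finset.Ico m e' ⊆ Finset.Ico m (max e e') :=
    Finset.Ico_subset_Ico_right (le_max_right _ _)
  refine ⟨max e e', fun k => a * c k + b * c' k, fun k => ?_, fun k hk => ?_, ?_, ?_⟩
  · have := hc k
    have := hc' k
    positivity
  · beta_reduce
    rw [hce k fun h => hk (h1 h), hce' k fun h => hk (h2 h)]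
    ring
  · rw [Finset.sum_add_distrib, ← Finset.mul_sum, ← Finset.mul_sum,
      ← Finset.sum_subset h1 fun k _ hk => hce k hk, ← Finset.sum_subset h2 fun k _ hk => hce' k hk,
      hc1, hc1', mul_one, mul_one, hab]
  · rw [Finset.sum_subset h1 fun k _ hk => by rw [hce k hk, zero_smul],
      Finset.sum_subset h2 fun k _ hk => by rw [hce' k hk, zero_smul],
      Finset.smul_sum, Finset.smul_sum, ← Finset.sum_add_distrib]
    refine Finset.sum_congr rfl fun k _ => ?_
    rw [smul_smul, smul_smul, ← add_smul]

/-- A positive functional on `C(K)` tends to zero along bounded pointwise null sequences. -/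
lemma tendsto_of_positive [CompactSpace K] [T2Space K] (Λ : C(K, ℝ) →ₗ[ℝ] ℝ) (hΛ : ∀ f : C(K, ℝ), 0 ≤ f → 0 ≤ Λ f)
    (h : ℕ → C(K, ℝ)) {M : ℝ} (hM : ∀ k x, |h k x| ≤ M)
    (h0 : ∀ x, Filter.Tendsto (fun k => h k x) Filter.atTop (nhds 0)) :
    Filter.Tendsto (fun k => Λ (h k)) Filter.atTop (nhds 0) := by
  -- The Riesz–Markov theorem represents `Λ` by a finite measure, and dominated convergence applies.
  borelize K
  let Λ' : CompactlySupportedContinuousMap K ℝ →ₚ[ℝ] ℝ :=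
    { toFun := fun f => Λ f.toContinuousMap
      map_add' := fun f g => map_add Λ f.toContinuousMap g.toContinuousMap
      map_smul' := fun c f => map_smul Λ c f.toContinuousMap
      monotone' := fun f g hfg => by
        have := hΛ (g.toContinuousMap - f.toContinuousMap) (fun x => sub_nonneg.2 (hfg x))
        rw [map_sub] at this
        exact sub_nonneg.1 this }
  let h' : ℕ → CompactlySupportedContinuousMap K ℝ := fun k =>
    { toContinuousMap := h k
      hasCompactSupport' := HasCompactSupport.of_compactSpace _ }
  have h1 : ∀ k, Λ (h k) = ∫ x, h k x ∂(RealRMK.rieszMeasure Λ') := fun k =>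
    (RealRMK.integral_rieszMeasure Λ' (h' k)).symm
  simp only [h1]
  have h2 := MeasureTheory.tendsto_integral_of_dominated_convergence
    (μ := RealRMK.rieszMeasure Λ') (F := fun k x => h k x) (f := fun _ => 0) (fun _ => M)
    (fun k => (h k).continuous.aestronglyMeasurable) (MeasureTheory.integrable_const M)
    (fun k => Filter.Eventually.of_forall fun x => hM k x) (Filter.Eventually.of_forall h0)
  simpa using h2

/-- A form of Mazur's lemma. If no combination were small, Hahn–Banach separation would give a
positive functional bounded below by some u > 0 on the |g k|, against `tendsto_of_positive`. -/
lemma exists_convexCombination_lt [CompactSpace K] [T2Space K] (g : ℕ → C(K, ℝ)) {M : ℝ} (hM : ∀ k x, |g k x| ≤ M)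
    (h0 : ∀ x, Filter.Tendsto (fun k => g k x) Filter.atTop (nhds 0)) (m : ℕ) {ε : ℝ}
    (hε : 0 < ε) :
    ∃ (e : ℕ) (c : ℕ → ℝ), (∀ k, 0 ≤ c k) ∧ ∑ k ∈ Finset.Ico m e, c k = 1 ∧
      ∀ x, |∑ k ∈ Finset.Ico m e, c k * g k x| < ε := by
  let h : ℕ → C(K, ℝ) := fun k => |g k|
  -- Unbounded below on purpose: a functional bounded above on `B` must be positive.
  let B : Set C(K, ℝ) := {f | ∀ x, f x < ε}
  have hB : Convex ℝ B := by
    intro f hf f' hf' a b ha hb hab x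
    have := hf x
    have := hf' x
    simp only [ContinuousMap.add_apply, ContinuousMap.smul_apply, smul_eq_mul]
    rcases ha.eq_or_lt with rfl | ha
    · have : b = 1 := by linarith
      subst this
      linarith
    · calc a * f x + b * f' x < a * ε + b * ε := by
            have := mul_lt_mul_of_pos_left (hf x) ha
            have := mul_le_mul_of_nonneg_left (hf' x).le hb
            linarith
        _ = ε := by rw [← add_mul, hab, one_mul]
  have hBo : IsOpen B := by
    have := ContinuousMap.isOpen_setOfPred_mapsTo (X := K) (Y := ℝ) isCompact_univ (isOpen_Iio (a := ε))
    convert this using 1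
    ext f
    simp [B, Set.MapsTo]
  by_cases hdis : Disjoint B (convexCombinations h m)
  · exfalso
    obtain ⟨Λ, u, hΛB, hΛA⟩ := geometric_hahn_banach_open hB hBo (convex_convexCombinations h m) hdis
    have hu : 0 < u := by simpa using hΛB 0 (fun x => by simpa using hε)
    have hpos : ∀ f : C(K, ℝ), 0 ≤ f → 0 ≤ Λ f := by
      intro f hf
      by_contra hneg
      push Not at hneg
      have h1 := hΛB (-(u / -Λ f) • f) (fun x => by
        have h2 : 0 ≤ u / -Λ f := by
          have : 0 < -Λ f := by linarith
          positivity
        have h3 : 0 ≤ f x := hf x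
        simp only [ContinuousMap.smul_apply, smul_eq_mul]
        nlinarith)
      rw [map_smul, smul_eq_mul] at h1
      have h2 : -(u / -Λ f) * Λ f = u := by
        have := hneg.ne
        field_simp
      linarith
    have ht := tendsto_of_positive (Λ : C(K, ℝ) →ₗ[ℝ] ℝ) hpos h (M := M)
      (fun k x => by simpa [h] using hM k x) (fun x => by simpa [h] using (h0 x).abs)
    have hge : ∀ k ≥ m, u ≤ Λ (h k) := fun k hk => hΛA _ ⟨k + 1, fun i => if i = k then 1 else 0,
      fun i => by beta_reduce; split_ifs <;> norm_num, fun i hi => by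
        beta_reduce
        rw [if_neg]
        rintro rfl
        exact hi (Finset.mem_Ico.2 ⟨hk, Nat.lt_succ_self i⟩), by simp [hk], by simp [hk]⟩
    have := ge_of_tendsto ht (Filter.eventually_atTop.2 ⟨m, hge⟩)
    linarith
  · obtain ⟨f, hfB, e, c, hc, -, hc1, rfl⟩ := Set.not_disjoint_iff.1 hdis
    refine ⟨e, c, hc, hc1, fun x => (Finset.abs_sum_le_sum_abs _ _).trans_lt ?_⟩
    have := hfB x
    simpa [h, abs_mul, abs_of_nonneg (hc _)] using this

end Mazur

/-! ### Sums of operators with `2`-estimates -/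

section OperatorSum

variable {E ι : Type*} [NormedAddCommGroup E] [NormedSpace ℝ E] {V : ι → E →L[ℝ] E} {A C : ℝ}

/-- The lower estimate makes ‖V i x‖² summable, and the upper one turns small tails of squares into
small tails of vectors. -/
lemma exists_hasSum_operator [CompleteSpace E] (hA : 0 ≤ A)
    (hupper : ∀ (s : Finset ι) (x : ι → E),
      ‖∑ i ∈ s, V i (x i)‖ ^ 2 ≤ A * ∑ i ∈ s, ‖V i (x i)‖ ^ 2)
    (hlower : ∀ (s : Finset ι) (x : E), ∑ i ∈ s, ‖V i x‖ ^ 2 ≤ C * ‖x‖ ^ 2) :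
    ∃ W : E →L[ℝ] E, ∀ x, HasSum (fun i => V i x) (W x) := by
  have hs : ∀ x, Summable fun i => V i x := by
    intro x
    have h1 : Summable fun i => ‖V i x‖ ^ 2 :=
      summable_of_sum_le (fun _ => sq_nonneg _) fun s => hlower s x
    refine summable_iff_vanishing_norm.2 fun ε hε => ?_
    obtain ⟨s, hs⟩ := summable_iff_vanishing_norm.1 h1 (ε ^ 2 / (A + 1)) (by positivity)
    refine ⟨s, fun t ht => ?_⟩
    have h2 := (le_abs_self _).trans_lt (hs t ht)
    rw [lt_div_iff₀ (by positivity)] at h2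
    have h3 := hupper t fun _ => x
    have h4 : 0 ≤ ∑ i ∈ t, ‖V i x‖ ^ 2 := Finset.sum_nonneg fun _ _ => sq_nonneg _
    refine lt_of_pow_lt_pow_left₀ 2 hε.le ?_
    nlinarith
  let L : E →ₗ[ℝ] E :=
    { toFun := fun y => ∑' i, V i y
      map_add' := fun y z => by
        rw [← (hs y).tsum_add (hs z)]
        exact tsum_congr fun i => map_add _ _ _
      map_smul' := fun c y => by
        rw [RingHom.id_apply, ← (hs y).tsum_const_smul c]
        exact tsum_congr fun i => map_smul _ _ _ }
  have hL : ∀ y, ‖L y‖ ≤ √(A * C) * ‖y‖ := fun y => by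
    have h1 : HasSum (fun i => V i y) (L y) := (hs y).hasSum
    refine le_of_tendsto h1.norm (Filter.Eventually.of_forall fun s => ?_)
    have h2 := (hupper s fun _ => y).trans (mul_le_mul_of_nonneg_left (hlower s y) hA)
    rw [← mul_assoc] at h2
    calc _ ≤ √(A * C * ‖y‖ ^ 2) := Real.le_sqrt_of_sq_le h2
      _ = _ := by rw [Real.sqrt_mul' _ (sq_nonneg _), Real.sqrt_sq (norm_nonneg _)]
  exact ⟨L.mkContinuous _ hL, fun y => (hs y).hasSum⟩

/-- Under `2`-estimates, `∑ V_i x` converges weakly uniformly on the unit ball. -/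
lemma exists_finset_dual_sub_sum_le
    (hupper : ∀ (s : Finset ι) (x : ι → E),
      ‖∑ i ∈ s, V i (x i)‖ ^ 2 ≤ A * ∑ i ∈ s, ‖V i (x i)‖ ^ 2)
    (hlower : ∀ (s : Finset ι) (x : E), ∑ i ∈ s, ‖V i x‖ ^ 2 ≤ C * ‖x‖ ^ 2)
    (hA : 0 ≤ A) (hC : 0 ≤ C) {W : E →L[ℝ] E} (hW : ∀ x, HasSum (fun i => V i x) (W x))
    (φ : E →L[ℝ] ℝ) {δ : ℝ} (hδ : 0 < δ) :
    ∃ s : Finset ι, ∀ x, ‖x‖ ≤ 1 → |φ (W x) - ∑ i ∈ s, φ (V i x)| ≤ δ := by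
  classical
  by_contra hcon
  push Not at hcon
  -- N disjoint sets of this kind, each with its own vector, would give Nδ ≤ ‖φ‖√(ANC), impossible
  -- for large N. This is why `hupper` allows a different argument in each term.
  have step : ∀ s : Finset ι, ∃ (t : Finset ι) (x : E), Disjoint s t ∧ ‖x‖ ≤ 1 ∧
      δ ≤ ∑ i ∈ t, φ (V i x) := by
    intro s
    obtain ⟨x, hx, hxs⟩ := hcon s
    have h1 : HasSum (fun i => φ (V i x)) (φ (W x)) := φ.hasSum (hW x)
    have h2 := (h1.sub_const (∑ i ∈ s, φ (V i x))).abs.eventually (lt_mem_nhds hxs)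
    obtain ⟨t, ht, hst⟩ := (h2.and (Filter.eventually_ge_atTop s)).exists
    have h3 : ∑ i ∈ t, φ (V i x) - ∑ i ∈ s, φ (V i x) = ∑ i ∈ t \ s, φ (V i x) := by
      rw [← Finset.sum_sdiff hst]
      ring
    rw [h3] at ht
    rcases lt_abs.1 ht with h | h
    · exact ⟨t \ s, x, Finset.disjoint_sdiff, hx, h.le⟩
    · refine ⟨t \ s, -x, Finset.disjoint_sdiff, by rwa [norm_neg], ?_⟩
      simp only [map_neg, Finset.sum_neg_distrib]
      exact h.le
  have main : ∀ N : ℕ, ∃ (s : Finset ι) (x : ι → E), N * δ ≤ φ (∑ i ∈ s, V i (x i)) ∧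
      ∑ i ∈ s, ‖V i (x i)‖ ^ 2 ≤ N * C := by
    intro N
    induction N with
    | zero => exact ⟨∅, 0, by simp, by simp⟩
    | succ N ih =>
      obtain ⟨s, x, h1, h2⟩ := ih
      obtain ⟨t, y, hst, hy, h3⟩ := step s
      obtain ⟨z, hzs, hzt⟩ : ∃ z : ι → E, (∀ i ∈ s, z i = x i) ∧ ∀ i ∈ t, z i = y :=
        ⟨fun i => if i ∈ s then x i else y, fun i hi => if_pos hi,
          fun i hi => if_neg (Finset.disjoint_right.1 hst hi)⟩
      refine ⟨s ∪ t, z, ?_, ?_⟩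
      · rw [Finset.sum_union hst, Finset.sum_congr rfl fun i hi => by rw [hzs i hi],
          Finset.sum_congr (s₁ := t) rfl fun i hi => by rw [hzt i hi], map_add, map_sum φ _ t]
        push_cast
        linarith
      · rw [Finset.sum_union hst, Finset.sum_congr rfl fun i hi => by rw [hzs i hi],
          Finset.sum_congr (s₁ := t) rfl fun i hi => by rw [hzt i hi]]
        have h4 := hlower t y
        have h5 : C * ‖y‖ ^ 2 ≤ C := mul_le_of_le_one_right hC (pow_le_one₀ (norm_nonneg _) hy)
        push_cast
        linarith
  obtain ⟨N, hN⟩ := exists_nat_gt (‖φ‖ ^ 2 * A * C / δ ^ 2)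
  obtain ⟨s, x, h1, h2⟩ := main N
  have hN0 : (0 : ℝ) < N := lt_of_le_of_lt (by positivity) hN
  rw [div_lt_iff₀ (by positivity)] at hN
  have h3 : φ (∑ i ∈ s, V i (x i)) ≤ ‖φ‖ * ‖∑ i ∈ s, V i (x i)‖ :=
    (le_abs_self _).trans (φ.le_opNorm _)
  have h4 : (N * δ) ^ 2 ≤ (‖φ‖ * ‖∑ i ∈ s, V i (x i)‖) ^ 2 :=
    pow_le_pow_left₀ (by positivity) (h1.trans h3) 2
  have h5 : ‖φ‖ ^ 2 * ‖∑ i ∈ s, V i (x i)‖ ^ 2 ≤ ‖φ‖ ^ 2 * (A * (N * C)) := by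
    gcongr
    exact (hupper s x).trans (mul_le_mul_of_nonneg_left h2 hA)
  nlinarith

end OperatorSum

/-! ### The unit ball of `JT` in the topology of pointwise convergence -/

namespace JT

/-- The ball is cut out of a product of intervals [-1, 1] by closed conditions, one for each segment
family. -/
lemma isCompact_coeff_ball : IsCompact (coeff '' {x : JT | ‖x‖ ≤ 1}) := by
  have h1 : coeff '' {x : JT | ‖x‖ ≤ 1} =
      ⋂ F : SegmentFamily, {y : Node → ℝ | familyNorm F y ≤ 1} := by
    ext y
    simp only [Set.mem_image, Set.mem_iInter, Set.mem_ofPred_eq]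
    constructor
    · rintro ⟨x, hx, rfl⟩ F
      exact (familyNorm_le_norm F x).trans hx
    · intro hy
      have hmem : y ∈ jtSubmodule := ⟨1, by rintro _ ⟨F, rfl⟩; exact hy F⟩
      exact ⟨mk y hmem, ciSup_le hy, rfl⟩
  refine IsCompact.of_isClosed_subset
    (isCompact_univ_pi fun _ : Node => isCompact_Icc (a := (-1 : ℝ)) (b := 1)) ?_ ?_
  · rw [h1]
    exact isClosed_iInter fun F => isClosed_le (continuous_familyNorm F) continuous_const
  · rintro _ ⟨x, hx, rfl⟩ α -
    exact abs_le.1 ((abs_coeff_le_norm x α).trans hx)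

/-- An operator on `JT` is weakly compact if, on the unit ball, every functional of its values is
a uniform limit of combinations of coordinates. -/
lemma mapsBallToWeaklyCompact_of_coordinates {F : Type*} [NormedAddCommGroup F] [NormedSpace ℝ F]
    (W : JT →L[ℝ] F)
    (h : ∀ φ : F →L[ℝ] ℝ, ∀ δ > 0, ∃ (A : Finset Node) (a : Node → ℝ), ∀ x, ‖x‖ ≤ 1 →
      |φ (W x) - ∑ α ∈ A, a α * x.coeff α| ≤ δ) : MapsBallToWeaklyCompact W := by
  let B := {x : JT // ‖x‖ ≤ 1}
  let τ : TopologicalSpace B := TopologicalSpace.induced (fun x => x.1.coeff) inferInstance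
  have hτ : Topology.IsInducing fun x : B => x.1.coeff := ⟨rfl⟩
  have hcomp : CompactSpace B := by
    refine ⟨hτ.isCompact_iff.2 ?_⟩
    convert isCompact_coeff_ball using 1
    ext y
    simp [B]
  -- Each φ ∘ W is a uniform limit on the ball of finite combinations of coordinates, hence
  -- pointwise continuous there.
  have hcont : Continuous fun x : B => toWeakSpace ℝ F (W x.1) := by
    refine continuous_weakSpace_of_forall fun φ => ?_
    choose A a ha using fun k : ℕ => h φ (1 / (k + 1)) (by positivity)
    have hu : TendstoUniformly (fun (k : ℕ) (x : B) => ∑ α ∈ A k, a k α * x.1.coeff α)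
        (fun x : B => φ (W x.1)) Filter.atTop := by
      rw [Metric.tendstoUniformly_iff]
      intro ε hε
      obtain ⟨N, hN⟩ := exists_nat_one_div_lt hε
      filter_upwards [Filter.eventually_ge_atTop N] with k hk x
      rw [Real.dist_eq]
      refine (ha k x.1 x.2).trans_lt (lt_of_le_of_lt ?_ hN)
      exact one_div_le_one_div_of_le (by positivity) (by exact_mod_cast Nat.succ_le_succ hk)
    refine hu.continuous (Filter.Frequently.of_forall fun k => ?_)
    refine continuous_finsetSum _ fun α _ => continuous_const.mul ?_
    exact (continuous_apply α).comp hτ.continuous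
  exact ⟨Set.range fun x : B => toWeakSpace ℝ F (W x.1), isCompact_range hcont,
    fun x hx => ⟨⟨x, hx⟩, rfl⟩⟩

/-! ### Combinatorics of trunks -/

/-- The node does not end with the entry `0`; such nodes are the starting points of trunks. -/
def IsTrunkStart (p : Node) : Prop := ∀ q : Node, p ≠ q ++ [false]

/-- The piece of the trunk of `p` between the levels `a` (included) and `b` (excluded). -/
def trunkSet (p : Node) (a b : ℕ) : Set Node := {α | ∃ k, a ≤ k ∧ k < b ∧ α = trunkNode p k}

lemma trunkNode_mem_trunkSet {p : Node} {a b k : ℕ} :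
    trunkNode p k ∈ trunkSet p a b ↔ a ≤ k ∧ k < b := by
  constructor
  · rintro ⟨l, h1, h2, h3⟩
    rw [trunkNode_injective p h3]
    exact ⟨h1, h2⟩
  · rintro ⟨h1, h2⟩
    exact ⟨k, h1, h2, rfl⟩

lemma exists_eq_trunkNode {p c : Node} {l : ℕ} (h1 : p <+: c) (h2 : c <+: trunkNode p l) :
    ∃ k ≤ l, c = trunkNode p k := by
  obtain ⟨t, rfl⟩ := h1
  rw [trunkNode, List.prefix_append_right_inj, List.prefix_replicate_iff] at h2
  exact ⟨t.length, h2.1, by rw [trunkNode, ← h2.2]⟩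

lemma isOrdConvex_trunkSet (p : Node) (a b : ℕ) : IsOrdConvex (trunkSet p a b) := by
  rintro _ ⟨k, hk, -, rfl⟩ _ ⟨l, -, hl, rfl⟩ c hkc hcl
  obtain ⟨m, hm, rfl⟩ := exists_eq_trunkNode ((prefix_trunkNode p k).trans hkc) hcl
  have := hkc.length_le
  simp only [length_trunkNode] at this
  exact ⟨m, by omega, by omega, rfl⟩

lemma IsTrunkStart.eq {p q : Node} (hp : IsTrunkStart p) (hq : IsTrunkStart q) {k l : ℕ}
    (h : trunkNode p k = trunkNode q l) : p = q := by
  have key : ∀ {p q : Node} {k l : ℕ}, IsTrunkStart q → trunkNode p k = trunkNode q l →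
      p <+: q → p = q := by
    intro p q k l hq h hpq
    obtain ⟨m, -, rfl⟩ := exists_eq_trunkNode hpq (h ▸ prefix_trunkNode q l)
    cases m with
    | zero => simp
    | succ m => exact absurd (trunkNode_succ p m) (hq _)
  rcases List.prefix_or_prefix_of_prefix (prefix_trunkNode p k) (h ▸ prefix_trunkNode q l) with h' | h'
  · exact key hq h h'
  · exact (key hp h.symm h').symm

/-- Strip the trailing zeros. With `IsTrunkStart.eq` this says that the trunks partition the tree.
-/
lemma exists_isTrunkStart (α : Node) : ∃ p k, IsTrunkStart p ∧ α = trunkNode p k := by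
  induction α using List.reverseRecOn with
  | nil => exact ⟨[], 0, fun q h => by simp at h, by simp⟩
  | append_singleton α b ih =>
    cases b
    · obtain ⟨p, k, hp, rfl⟩ := ih
      exact ⟨p, k + 1, hp, (trunkNode_succ p k).symm⟩
    · exact ⟨α ++ [true], 0, fun q h => by simp at h, by simp⟩

/-- If p is a proper initial segment of q, then q ends in a one that p lacks. Hence a path passes at
most n + 1 trunk starts of T_n. -/
lemma IsTrunkStart.eq_of_count {p q γ : Node} (hp : IsTrunkStart p) (hq : IsTrunkStart q)
    (hpγ : p <+: γ) (hqγ : q <+: γ) (h : p.count true = q.count true) : p = q := by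
  have key : ∀ {p q : Node}, IsTrunkStart q → p.count true = q.count true → p <+: q → p = q := by
    intro p q hq h hpq
    rcases List.eq_nil_or_concat' q with rfl | ⟨r, b, rfl⟩
    · simpa using hpq
    · rcases List.prefix_concat_iff.1 hpq with h1 | h1
      · exact h1
      · cases b
        · exact absurd rfl (hq r)
        · have := h1.sublist.count_le true
          rw [List.count_append] at h
          simp at h
          omega
  rcases List.prefix_or_prefix_of_prefix hpγ hqγ with h' | h'
  · exact key hq h h'
  · exact (key hp h.symm h').symm

lemma exists_trunkNode_prefix_iff {p γ : Node} (h : p <+: γ) :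
    ∃ k, ∀ i, trunkNode p i <+: γ ↔ i ≤ k := by
  classical
  have hex : ∃ k, ¬ trunkNode p (k + 1) <+: γ := by
    refine ⟨γ.length, fun h' => ?_⟩
    have := h'.length_le
    rw [length_trunkNode] at this
    omega
  refine ⟨Nat.find hex, fun i => ⟨fun hi => ?_, fun hi => ?_⟩⟩
  · by_contra hlt
    exact Nat.find_spec hex ((trunkNode_prefix p (by omega)).trans hi)
  · cases i with
    | zero => simpa using h
    | succ i => exact not_not.1 (Nat.find_min hex (Nat.lt_of_succ_le hi))

lemma disjoint_trunkSet {p q : Node} (hp : IsTrunkStart p) (hq : IsTrunkStart q)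
    {a b a' b' : ℕ} (h : p = q → b ≤ a' ∨ b' ≤ a) :
    Disjoint (trunkSet p a b) (trunkSet q a' b') := by
  rw [Set.disjoint_left]
  rintro _ ⟨k, h1, h2, rfl⟩ ⟨l, h3, h4, h5⟩
  obtain rfl := hp.eq hq h5
  have := trunkNode_injective p h5
  have := h rfl
  omega

/-! ### Path sums on trunks -/

lemma pathSum_append (α : Node) (b : Bool) (x : Node → ℝ) :
    pathSum (α ++ [b]) x = pathSum α x + x (α ++ [b]) := by
  have h : below (α ++ [b]) = insert (α ++ [b]) (below α) := by
    ext γ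
    rw [Finset.mem_insert, mem_below, mem_below, List.prefix_concat_iff]
  rw [pathSum, h, Finset.sum_insert, pathSum, add_comm]
  rw [mem_below]
  intro h'
  have := h'.length_le
  simp at this

lemma pathSum_trunkNode (p : Node) (k : ℕ) (x : Node → ℝ) :
    pathSum (trunkNode p k) x = pathSum p x - x p + ∑ i ∈ Finset.range (k + 1), x (trunkNode p i) := by
  induction k with
  | zero => simp
  | succ k ih =>
    rw [trunkNode_succ, pathSum_append, ih, Finset.sum_range_succ _ (k + 1), trunkNode_succ]
    ring

lemma abs_branchL_le (p : Node) (x : JT) : |branchL p x| ≤ ‖x‖ :=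
  le_of_tendsto (tendsto_branchL p x).abs (Filter.Eventually.of_forall fun _ => abs_pathSum_le _ x)

/-! ### Vectors supported on an initial piece of a trunk -/

section Supported

variable {p : Node} {w : JT} {b : ℕ}

lemma sum_eq_of_support (hw : ∀ α, α ∉ trunkSet p 0 b → w.coeff α = 0) {S : Finset Node}
    (hS : ∀ i < b, trunkNode p i ∈ S) :
    ∑ α ∈ S, w.coeff α = ∑ i ∈ Finset.range b, w.coeff (trunkNode p i) := by
  classical
  rw [← Finset.sum_image (f := w.coeff) (g := trunkNode p) (s := Finset.range b)
    (trunkNode_injective p).injOn]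
  symm
  refine Finset.sum_subset (fun α hα => ?_) fun α _ hα => hw α ?_
  · obtain ⟨i, hi, rfl⟩ := Finset.mem_image.1 hα
    exact hS i (Finset.mem_range.1 hi)
  · rintro ⟨i, -, hi, rfl⟩
    exact hα (Finset.mem_image_of_mem _ (Finset.mem_range.2 hi))

lemma branchL_eq_sum (hw : ∀ α, α ∉ trunkSet p 0 b → w.coeff α = 0) :
    branchL p w = ∑ i ∈ Finset.range b, w.coeff (trunkNode p i) := by
  refine tendsto_nhds_unique (tendsto_branchL p w) (tendsto_const_nhds.congr' ?_)
  filter_upwards [Filter.eventually_ge_atTop b] with l hl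
  exact (sum_eq_of_support hw fun i hi => mem_below.2 (trunkNode_prefix p (by omega))).symm

end Supported

/-! ### Upper estimates -/

/-- A segment sum involves at most two path sums, so at most 2N of the vectors contribute to it;
apply the Cauchy–Schwarz inequality to these. -/
lemma norm_sum_sq_le_of_card {ι : Type*} (s : Finset ι) (w : ι → JT) (N : ℕ)
    (h : ∀ γ, (s.filter fun i => pathSum γ (w i).coeff ≠ 0).card ≤ N) :
    ‖∑ i ∈ s, w i‖ ^ 2 ≤ (2 * N : ℕ) * ∑ i ∈ s, ‖w i‖ ^ 2 := by
  classical
  have hnn : (0 : ℝ) ≤ (2 * N : ℕ) * ∑ i ∈ s, ‖w i‖ ^ 2 :=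
    mul_nonneg (Nat.cast_nonneg _) (Finset.sum_nonneg fun _ _ => sq_nonneg _)
  have hseg : ∀ S, IsSegment S → (∑ α ∈ S, (∑ i ∈ s, w i).coeff α) ^ 2 ≤
      (2 * N : ℕ) * ∑ i ∈ s, (∑ α ∈ S, (w i).coeff α) ^ 2 := by
    intro S hS
    have h1 : ∑ α ∈ S, (∑ i ∈ s, w i).coeff α = ∑ i ∈ s, ∑ α ∈ S, (w i).coeff α := by
      rw [Finset.sum_comm]
      exact Finset.sum_congr rfl fun α _ => coeff_sum s w α
    have h2 : (s.filter fun i => ∑ α ∈ S, (w i).coeff α ≠ 0).card ≤ 2 * N := by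
      obtain ⟨β, hβ | ⟨α, hβα⟩⟩ := hS.sum_eq
      · simp only [hβ]
        exact (h β).trans (by omega)
      · refine (Finset.card_le_card (t := (s.filter fun i => pathSum β (w i).coeff ≠ 0) ∪
          s.filter fun i => pathSum α (w i).coeff ≠ 0) fun i hi => ?_).trans
          ((Finset.card_union_le _ _).trans ?_)
        · simp only [Finset.mem_filter, Finset.mem_union, hβα] at hi ⊢
          by_contra hcon
          push Not at hcon
          have h3 := hcon.1 hi.1
          have h4 := hcon.2 hi.1
          exact hi.2 (by rw [h3, h4, sub_zero])
        · have := h β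
          have := h α
          omega
    rw [h1, ← Finset.sum_filter_ne_zero]
    refine sq_sum_le_card_mul_sum_sq.trans ?_
    refine mul_le_mul (by exact_mod_cast h2) ?_ (Finset.sum_nonneg fun _ _ => sq_nonneg _)
      (Nat.cast_nonneg _)
    exact Finset.sum_le_sum_of_subset_of_nonneg (Finset.filter_subset _ _)
      fun _ _ _ => sq_nonneg _
  have hle : ‖∑ i ∈ s, w i‖ ≤ √((2 * N : ℕ) * ∑ i ∈ s, ‖w i‖ ^ 2) := by
    refine norm_le (Real.sqrt_nonneg _) fun F => ?_
    rw [Real.sq_sqrt hnn]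
    refine (Finset.sum_le_sum fun S hS => hseg S (F.2.1 S hS)).trans ?_
    rw [← Finset.mul_sum, Finset.sum_comm]
    gcongr with i hi
    exact SegmentFamily.sum_sq_le F (w i)
  calc _ ≤ √((2 * N : ℕ) * ∑ i ∈ s, ‖w i‖ ^ 2) ^ 2 := by gcongr
    _ = _ := Real.sq_sqrt hnn

/-- The starting points of the trunks in `T_n`. -/
abbrev TrunkIndex (n : ℕ) : Type := {p : Node // p ∈ subtree n ∧ IsTrunkStart p}

/-! ### Blocks seen by a path -/

section BlockSystem

variable {n : ℕ} {e : TrunkIndex n → ℕ → ℕ}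

/-- At most `3 (n + 1)` blocks are seen by a path. -/
lemma card_filter_pathSum_ne_zero_le (he0 : ∀ p, e p 0 = 0) (he : ∀ p, StrictMono (e p))
    (s : Finset (TrunkIndex n × ℕ)) (w : TrunkIndex n × ℕ → JT)
    (hsupp : ∀ i α, α ∉ trunkSet i.1.1 (e i.1 (i.2 - 1)) (e i.1 (i.2 + 1)) → (w i).coeff α = 0)
    (hzero : ∀ i : TrunkIndex n × ℕ, i.2 ≠ 0 → branchL i.1.1 (w i) = 0) (γ : Node) :
    (s.filter fun i => pathSum γ (w i).coeff ≠ 0).card ≤ 3 * (n + 1) := by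
  classical
  set t := s.filter fun i => pathSum γ (w i).coeff ≠ 0 with ht
  have hprefix : ∀ i ∈ t, i.1.1 <+: γ := by
    intro i hi
    by_contra hcon
    refine (Finset.mem_filter.1 hi).2 (Finset.sum_eq_zero fun α hα => hsupp i α ?_)
    rintro ⟨k, -, -, rfl⟩
    exact hcon ((prefix_trunkNode _ k).trans (mem_below.1 hα))
  have hfib : ∀ m ∈ Finset.range (n + 1), (t.filter fun i => i.1.1.count true = m).card ≤ 3 := by
    intro m _
    rcases (t.filter fun i => i.1.1.count true = m).eq_empty_or_nonempty with h | ⟨i₀, hi₀⟩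
    · rw [h]
      simp
    rw [Finset.mem_filter] at hi₀
    have hsame : ∀ i ∈ t.filter (fun i => i.1.1.count true = m), i.1 = i₀.1 := by
      intro i hi
      rw [Finset.mem_filter] at hi
      exact Subtype.ext (i.1.2.2.eq_of_count i₀.1.2.2 (hprefix i hi.1) (hprefix i₀ hi₀.1)
        (hi.2.trans hi₀.2.symm))
    obtain ⟨k, hk⟩ := exists_trunkNode_prefix_iff (hprefix i₀ hi₀.1)
    obtain ⟨r, hr1, hr2⟩ : ∃ r, e i₀.1 r ≤ k ∧ k < e i₀.1 (r + 1) := by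
      have hex : ∃ r, k < e i₀.1 (r + 1) :=
        ⟨k, lt_of_lt_of_le (Nat.lt_succ_self k) ((he i₀.1).id_le (k + 1))⟩
      refine ⟨Nat.find hex, ?_, Nat.find_spec hex⟩
      cases hf : Nat.find hex with
      | zero => rw [he0]; omega
      | succ r =>
        have := Nat.find_min hex (m := r) (by omega)
        omega
    -- The path leaves this trunk at level `k`. A block whose support begins later is not seen; one
    -- whose support has been passed entirely contributes its branch sum, which is zero except
    -- possibly for block 0.
    have himage : (t.filter fun i => i.1.1.count true = m).card ≤ ({0, r, r + 1} : Finset ℕ).card := by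
      refine Finset.card_le_card_of_injOn (fun i => i.2) (fun i hi => ?_) fun i hi j hj hij => ?_
      · have h1 := hsame i hi
        have hit := (Finset.mem_filter.1 hi).1
        have hne := (Finset.mem_filter.1 hit).2
        by_contra hcon
        simp only [Finset.coe_insert, Finset.coe_singleton, Set.mem_insert_iff,
          Set.mem_singleton_iff, not_or] at hcon
        have hsupp' := hsupp i
        have hzero' := hzero i hcon.1
        rw [h1] at hsupp' hzero'
        have hsupp0 : ∀ α, α ∉ trunkSet i₀.1.1 0 (e i₀.1 (i.2 + 1)) → (w i).coeff α = 0 :=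
          fun α hα => hsupp' α fun ⟨l, _, h2, h3⟩ => hα ⟨l, Nat.zero_le _, h2, h3⟩
        rcases lt_or_ge k (e i₀.1 (i.2 - 1)) with hlt | hge
        · refine hne (Finset.sum_eq_zero fun α hα => hsupp' α ?_)
          rintro ⟨l, h2, -, rfl⟩
          have := (hk l).1 (mem_below.1 hα)
          omega
        · have h2 : e i₀.1 (i.2 + 1) ≤ k := by
            by_contra h3
            push Not at h3
            have h4 : r < i.2 + 1 := (he i₀.1).lt_iff_lt.1 (hr1.trans_lt h3)
            have h5 : i.2 - 1 < r + 1 := (he i₀.1).lt_iff_lt.1 (hge.trans_lt hr2)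
            omega
          refine hne ?_
          rw [pathSum, sum_eq_of_support hsupp0 fun l hl => mem_below.2 ((hk l).2 (by omega)),
            ← branchL_eq_sum hsupp0, hzero']
      · exact Prod.ext ((hsame i hi).trans (hsame j hj).symm) hij
    exact himage.trans Finset.card_le_three
  have hmaps : ∀ i ∈ t, i.1.1.count true ∈ Finset.range (n + 1) := fun i _ =>
    Finset.mem_range.2 (Nat.lt_succ_of_le i.1.2.1)
  have := Finset.card_le_mul_card_image_of_maps_to hmaps 3 hfib
  rwa [Finset.card_range] at this

end BlockSystem

end JT

/-- A difference of two averages is the average of the differences with product weights. -/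
lemma norm_convex_sub_le {E : Type*} [NormedAddCommGroup E] [NormedSpace ℝ E] {ι : Type*}
    {s t : Finset ι} {c c' : ι → ℝ} (hc : ∀ i, 0 ≤ c i) (hc' : ∀ i, 0 ≤ c' i)
    (hs : ∑ i ∈ s, c i = 1) (ht : ∑ i ∈ t, c' i = 1) (a b : ι → E) {N : ℝ}
    (h : ∀ i ∈ t, ∀ j ∈ s, ‖a i - b j‖ ≤ N) :
    ‖∑ i ∈ t, c' i • a i - ∑ j ∈ s, c j • b j‖ ≤ N := by
  have h1 : ∑ i ∈ t, c' i • a i - ∑ j ∈ s, c j • b j =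
      ∑ i ∈ t, ∑ j ∈ s, (c' i * c j) • (a i - b j) := by
    simp only [smul_sub, Finset.sum_sub_distrib]
    congr 1
    · refine Finset.sum_congr rfl fun i _ => ?_
      rw [← Finset.sum_smul, ← Finset.mul_sum, hs, mul_one]
    · rw [Finset.sum_comm]
      refine Finset.sum_congr rfl fun j _ => ?_
      rw [← Finset.sum_smul, ← Finset.sum_mul, ht, one_mul]
  rw [h1]
  calc _ ≤ ∑ i ∈ t, ∑ j ∈ s, (c' i * c j) * N := by
        refine (norm_sum_le _ _).trans (Finset.sum_le_sum fun i hi => (norm_sum_le _ _).trans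
          (Finset.sum_le_sum fun j hj => ?_))
        rw [norm_smul, Real.norm_of_nonneg (mul_nonneg (hc' i) (hc j))]
        exact mul_le_mul_of_nonneg_left (h i hi j hj) (mul_nonneg (hc' i) (hc j))
    _ = N := by
        simp only [← Finset.sum_mul, ← Finset.mul_sum, hs, ht, mul_one, one_mul]

namespace JT

/-! ### Block operators on a trunk -/

/-- A weighted average of the projections onto initial pieces of the trunk of `p`. -/
def trunkAvg (p : Node) (c : ℕ → ℝ) (a b : ℕ) : JT →L[ℝ] JT :=
  ∑ i ∈ Finset.Ico a b, c i • restrict (trunkSet p 0 (i + 1)) (isOrdConvex_trunkSet p 0 (i + 1))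

lemma trunkAvg_apply (p : Node) (c : ℕ → ℝ) (a b : ℕ) (x : JT) :
    trunkAvg p c a b x = ∑ i ∈ Finset.Ico a b,
      c i • restrict (trunkSet p 0 (i + 1)) (isOrdConvex_trunkSet p 0 (i + 1)) x := by
  simp [trunkAvg]

lemma coeff_trunkAvg_of_le {p : Node} {c : ℕ → ℝ} {a b k : ℕ}
    (hc : ∑ i ∈ Finset.Ico a b, c i = 1) (hk : k ≤ a) (x : JT) :
    (trunkAvg p c a b x).coeff (trunkNode p k) = x.coeff (trunkNode p k) := by
  rw [trunkAvg_apply, coeff_sum, ← one_mul (x.coeff _), ← hc, Finset.sum_mul]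
  refine Finset.sum_congr rfl fun i hi => ?_
  rw [coeff_smul, Pi.smul_apply, coeff_restrict, if_pos, smul_eq_mul]
  have := (Finset.mem_Ico.1 hi).1
  exact trunkNode_mem_trunkSet.2 ⟨Nat.zero_le _, by omega⟩

lemma coeff_trunkAvg_of_notMem {p : Node} {c : ℕ → ℝ} {a b : ℕ} {α : Node}
    (hα : α ∉ trunkSet p 0 b) (x : JT) : (trunkAvg p c a b x).coeff α = 0 := by
  rw [trunkAvg_apply, coeff_sum]
  refine Finset.sum_eq_zero fun i hi => ?_
  rw [coeff_smul, Pi.smul_apply, coeff_restrict, if_neg, smul_zero]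
  rintro ⟨k, h1, h2, rfl⟩
  have := (Finset.mem_Ico.1 hi).2
  exact hα (trunkNode_mem_trunkSet.2 ⟨h1, by omega⟩)

/-- Differences of successive averages. -/
def blockStep (p : Node) (e : ℕ → ℕ) (c : ℕ → ℕ → ℝ) : ℕ → JT →L[ℝ] JT
  | 0 => trunkAvg p (c 0) (e 0) (e 1)
  | j + 1 => trunkAvg p (c (j + 1)) (e (j + 1)) (e (j + 2)) - trunkAvg p (c j) (e j) (e (j + 1))

lemma sum_blockStep (p : Node) (e : ℕ → ℕ) (c : ℕ → ℕ → ℝ) (J : ℕ) :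
    ∑ j ∈ Finset.range (J + 1), blockStep p e c j = trunkAvg p (c J) (e J) (e (J + 1)) := by
  induction J with
  | zero => simp [blockStep]
  | succ J ih =>
    rw [Finset.sum_range_succ, ih, blockStep]
    abel

/-- The amount by which a difference of successive averages fails to have zero sum. -/
def blockExcess (p : Node) (e : ℕ → ℕ) (c : ℕ → ℕ → ℝ) : ℕ → JT →L[ℝ] JT
  -- The first block stays uncorrected. Each later one is corrected at the lowest level of its
  -- support, which is therefore not enlarged.
  | 0 => 0
  | j + 1 => ((branchL p).comp (blockStep p e c (j + 1))).smulRight (nodeVec (trunkNode p (e j)))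

/-- The block operators: from the second block on, their values have zero sum. -/
def blockOp (p : Node) (e : ℕ → ℕ) (c : ℕ → ℕ → ℝ) (j : ℕ) : JT →L[ℝ] JT :=
  blockStep p e c j - blockExcess p e c j

lemma branchL_blockOp (p : Node) (e : ℕ → ℕ) (c : ℕ → ℕ → ℝ) {j : ℕ} (hj : j ≠ 0) (x : JT) : branchL p (blockOp p e c j x) = 0 := by
  obtain ⟨j, rfl⟩ := Nat.exists_eq_succ_of_ne_zero hj
  have h1 : branchL p (nodeVec (trunkNode p (e j))) = 1 := by
    have hs : ∀ α, α ∉ trunkSet p 0 (e j + 1) → (nodeVec (trunkNode p (e j))).coeff α = 0 := by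
      intro α hα
      rw [coeff_nodeVec, if_neg]
      rintro rfl
      exact hα (trunkNode_mem_trunkSet.2 ⟨Nat.zero_le _, Nat.lt_succ_self _⟩)
    rw [branchL_eq_sum hs]
    simp [coeff_nodeVec, (trunkNode_injective p).eq_iff]
  rw [Nat.succ_eq_add_one, blockOp, sub_apply, blockExcess, ContinuousLinearMap.smulRight_apply,
    map_sub, map_smul, h1, ContinuousLinearMap.comp_apply, smul_eq_mul, mul_one, sub_self]

lemma branchL_restrict (p : Node) (i : ℕ) (x : JT) :
    branchL p (restrict (trunkSet p 0 (i + 1)) (isOrdConvex_trunkSet p 0 (i + 1)) x) =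
      pathSum (trunkNode p i) x.coeff - (pathSum p x.coeff - x.coeff p) := by
  classical
  rw [branchL_eq_sum (b := i + 1) fun α hα => by rw [coeff_restrict, if_neg hα], pathSum_trunkNode]
  rw [add_sub_cancel_left]
  refine Finset.sum_congr rfl fun k hk => ?_
  rw [coeff_restrict, if_pos (trunkNode_mem_trunkSet.2 ⟨Nat.zero_le _, Finset.mem_range.1 hk⟩)]

/-- Cutting levels `e` and weights `c j` on the blocks `[e j, e (j + 1))`. -/
structure IsBlockSystem (e : ℕ → ℕ) (c : ℕ → ℕ → ℝ) : Prop where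
  zero : e 0 = 0
  strictMono : StrictMono e
  nonneg : ∀ j k, 0 ≤ c j k
  sum_eq_one : ∀ j, ∑ k ∈ Finset.Ico (e j) (e (j + 1)), c j k = 1

namespace IsBlockSystem

variable {p : Node} {e : ℕ → ℕ} {c : ℕ → ℕ → ℝ}

/-- Step j + 1 is a difference of averages that agree below level `e j` and vanish from level `e (j
+ 2)` on. For j = 0 the truncated index gives the lower end `e 0 = 0`. -/
lemma coeff_blockStep (h : IsBlockSystem e c) (j : ℕ) (x : JT) {α : Node}
    (hα : α ∉ trunkSet p (e (j - 1)) (e (j + 1))) : (blockStep p e c j x).coeff α = 0 := by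
  cases j with
  | zero =>
    rw [Nat.zero_sub, h.zero] at hα
    exact coeff_trunkAvg_of_notMem hα x
  | succ j =>
    rw [Nat.add_sub_cancel] at hα
    rw [blockStep, sub_apply, coeff_sub, Pi.sub_apply]
    by_cases hα' : α ∈ trunkSet p 0 (e (j + 2))
    · obtain ⟨k, -, hk, rfl⟩ := hα'
      have h1 : k < e j := by
        by_contra hcon
        exact hα (trunkNode_mem_trunkSet.2 ⟨not_lt.1 hcon, hk⟩)
      rw [coeff_trunkAvg_of_le (h.sum_eq_one j) h1.le, coeff_trunkAvg_of_le (h.sum_eq_one (j + 1))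
        (h1.trans (h.strictMono (Nat.lt_succ_self j))).le, sub_self]
    · rw [coeff_trunkAvg_of_notMem hα', coeff_trunkAvg_of_notMem, sub_zero]
      rintro ⟨k, h1, h2, rfl⟩
      exact hα' (trunkNode_mem_trunkSet.2 ⟨h1, h2.trans (h.strictMono (Nat.lt_succ_self _))⟩)

lemma coeff_blockOp (h : IsBlockSystem e c) (j : ℕ) (x : JT) {α : Node}
    (hα : α ∉ trunkSet p (e (j - 1)) (e (j + 1))) : (blockOp p e c j x).coeff α = 0 := by
  rw [blockOp, sub_apply, coeff_sub, Pi.sub_apply, h.coeff_blockStep j x hα]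
  cases j with
  | zero => simp [blockExcess]
  | succ j =>
    rw [blockExcess, ContinuousLinearMap.smulRight_apply, coeff_smul, Pi.smul_apply, coeff_nodeVec,
      if_neg, smul_zero, sub_zero]
    rintro rfl
    exact hα (trunkNode_mem_trunkSet.2 ⟨le_rfl, h.strictMono (by omega)⟩)

/-- A step is an average of restrictions to trunk pieces inside its support, and restrictions are
contractive. -/
lemma norm_blockStep_le (h : IsBlockSystem e c) (j : ℕ) (x : JT) : ‖blockStep p e c j x‖ ≤
    ‖restrict (trunkSet p (e (j - 1)) (e (j + 1))) (isOrdConvex_trunkSet _ _ _) x‖ := by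
  classical
  cases j with
  | zero =>
    have := norm_convex_sub_le (h.nonneg 0) (h.nonneg 0) (h.sum_eq_one 0) (h.sum_eq_one 0)
      (fun i => restrict (trunkSet p 0 (i + 1)) (isOrdConvex_trunkSet p 0 (i + 1)) x) (fun _ => 0)
      (N := ‖restrict (trunkSet p (e (0 - 1)) (e (0 + 1))) (isOrdConvex_trunkSet _ _ _) x‖)
      fun i hi _ _ => by
        rw [sub_zero, ← restrict_restrict (isOrdConvex_trunkSet p 0 (i + 1))
          (isOrdConvex_trunkSet p (e (0 - 1)) (e (0 + 1)))]
        · exact norm_restrict_le _ _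
        · rintro _ ⟨k, h1, h2, rfl⟩
          have := (Finset.mem_Ico.1 hi).2
          refine trunkNode_mem_trunkSet.2 ⟨?_, by omega⟩
          rw [Nat.zero_sub, h.zero]
          exact h1
    simpa [blockStep, trunkAvg_apply] using this
  | succ j =>
    rw [blockStep, sub_apply, trunkAvg_apply, trunkAvg_apply]
    refine norm_convex_sub_le (h.nonneg j) (h.nonneg (j + 1)) (h.sum_eq_one j)
      (h.sum_eq_one (j + 1)) _ _ fun i hi i' hi' => ?_
    rw [Finset.mem_Ico] at hi hi'
    have h1 : restrict (trunkSet p 0 (i + 1)) (isOrdConvex_trunkSet p 0 (i + 1)) x -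
        restrict (trunkSet p 0 (i' + 1)) (isOrdConvex_trunkSet p 0 (i' + 1)) x =
        restrict (trunkSet p (i' + 1) (i + 1)) (isOrdConvex_trunkSet p (i' + 1) (i + 1)) x := by
      refine ext_coeff fun α => ?_
      rw [coeff_sub, Pi.sub_apply, coeff_restrict, coeff_restrict, coeff_restrict]
      by_cases hα : ∃ k, α = trunkNode p k
      · obtain ⟨k, rfl⟩ := hα
        simp only [trunkNode_mem_trunkSet, Nat.zero_le, true_and]
        by_cases h2 : k < i' + 1
        · rw [if_pos (by omega), if_pos h2, if_neg (by omega), sub_self]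
        · rw [if_neg h2, sub_zero]
          exact if_congr (by omega) rfl rfl
      · have : ∀ a b, α ∉ trunkSet p a b := fun a b ⟨k, _, _, hk⟩ => hα ⟨k, hk⟩
        simp [this]
    rw [h1, ← restrict_restrict (isOrdConvex_trunkSet p (i' + 1) (i + 1))
      (isOrdConvex_trunkSet p (e (j + 1 - 1)) (e (j + 1 + 1)))]
    · exact norm_restrict_le _ _
    · rintro _ ⟨k, h2, h3, rfl⟩
      refine trunkNode_mem_trunkSet.2 ⟨?_, by omega⟩
      rw [Nat.add_sub_cancel]
      omega

lemma norm_blockOp_le (h : IsBlockSystem e c) (j : ℕ) (x : JT) : ‖blockOp p e c j x‖ ≤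
    2 * ‖restrict (trunkSet p (e (j - 1)) (e (j + 1))) (isOrdConvex_trunkSet _ _ _) x‖ := by
  have h1 := h.norm_blockStep_le (p := p) j x
  have h2 : ‖blockExcess p e c j x‖ ≤ ‖blockStep p e c j x‖ := by
    cases j with
    | zero => simp [blockExcess]
    | succ j =>
      rw [blockExcess, ContinuousLinearMap.smulRight_apply, norm_smul,
        ContinuousLinearMap.comp_apply]
      calc _ ≤ ‖blockStep p e c (j + 1) x‖ * 1 :=
            mul_le_mul (abs_branchL_le _ _) (norm_nodeVec_le _) (norm_nonneg _) (norm_nonneg _)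
        _ = _ := mul_one _
  rw [blockOp, sub_apply]
  linarith [norm_sub_le (blockStep p e c j x) (blockExcess p e c j x)]

/-- A block operator depends only on finitely many coordinates. -/
lemma exists_blockOp_eq (h : IsBlockSystem e c) (p : Node) (j : ℕ) : ∃ A : Finset Node, ∀ x,
    blockOp p e c j x = ∑ α ∈ A, x.coeff α • blockOp p e c j (nodeVec α) := by
  classical
  set I := trunkSet p (e (j - 1)) (e (j + 1)) with hI
  have hIc : IsOrdConvex I := isOrdConvex_trunkSet _ _ _
  refine ⟨((Finset.range (e (j + 1))).image (trunkNode p)).filter (· ∈ I), fun x => ?_⟩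
  have h1 : blockOp p e c j (x - restrict I hIc x) = 0 := by
    have h2 := h.norm_blockOp_le (p := p) j (x - restrict I hIc x)
    have h3 : restrict I hIc (x - restrict I hIc x) = 0 := by
      rw [map_sub, restrict_restrict hIc hIc subset_rfl, sub_self]
    rw [h3, norm_zero, mul_zero] at h2
    exact norm_le_zero_iff.1 h2
  rw [map_sub, sub_eq_zero] at h1
  rw [h1, eq_sum_nodeVec (x := restrict I hIc x)
    (((Finset.range (e (j + 1))).image (trunkNode p)).filter (· ∈ I)) ?_, map_sum]
  · refine Finset.sum_congr rfl fun α hα => ?_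
    rw [map_smul, coeff_restrict, if_pos (Finset.mem_filter.1 hα).2]
  · intro α hα
    rw [coeff_restrict, if_neg]
    intro hαI
    refine hα (Finset.mem_filter.2 ⟨?_, hαI⟩)
    obtain ⟨k, -, hk, rfl⟩ := hαI
    exact Finset.mem_image_of_mem _ (Finset.mem_range.2 hk)

/-- The first two terms do not depend on j, so the branch sum of a difference of successive averages
consists of averaged tails alone. -/
lemma branchL_trunkAvg (h : IsBlockSystem e c) (p : Node) (j : ℕ) (x : JT) :
    branchL p (trunkAvg p (c j) (e j) (e (j + 1)) x) =
      branchL p x - (pathSum p x.coeff - x.coeff p) -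
        ∑ i ∈ Finset.Ico (e j) (e (j + 1)), c j i * (branchL p x - pathSum (trunkNode p i) x.coeff) := by
  have h1 : branchL p x - (pathSum p x.coeff - x.coeff p) = ∑ i ∈ Finset.Ico (e j) (e (j + 1)),
      c j i * (branchL p x - (pathSum p x.coeff - x.coeff p)) := by
    rw [← Finset.sum_mul, h.sum_eq_one, one_mul]
  rw [h1, ← Finset.sum_sub_distrib, trunkAvg_apply, map_sum]
  refine Finset.sum_congr rfl fun i _ => ?_
  rw [map_smul, branchL_restrict, smul_eq_mul]
  ring

lemma norm_blockExcess_le (h : IsBlockSystem e c) (j : ℕ) (x : JT) {η : ℝ}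
    (h1 : |∑ i ∈ Finset.Ico (e j) (e (j + 1)),
      c j i * (branchL p x - pathSum (trunkNode p i) x.coeff)| ≤ η)
    (h2 : |∑ i ∈ Finset.Ico (e (j + 1)) (e (j + 2)),
      c (j + 1) i * (branchL p x - pathSum (trunkNode p i) x.coeff)| ≤ η) :
    ‖blockExcess p e c (j + 1) x‖ ≤ 2 * η := by
  rw [blockExcess, ContinuousLinearMap.smulRight_apply, norm_smul, ContinuousLinearMap.comp_apply,
    blockStep, sub_apply, map_sub, h.branchL_trunkAvg, h.branchL_trunkAvg]
  refine (mul_le_of_le_one_right (norm_nonneg _) (norm_nodeVec_le _)).trans ?_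
  rw [Real.norm_eq_abs, abs_le]
  constructor <;> linarith [(abs_le.1 h1).1, (abs_le.1 h1).2, (abs_le.1 h2).1, (abs_le.1 h2).2]

end IsBlockSystem

/-! ### The sum of the block operators -/

section BlockSum

variable {n : ℕ} {e : TrunkIndex n → ℕ → ℕ} {c : TrunkIndex n → ℕ → ℕ → ℝ}

lemma sum_norm_sq_blockOp_le (h : ∀ p, IsBlockSystem (e p) (c p)) (s : Finset (TrunkIndex n × ℕ))
    (x : JT) :
    ∑ i ∈ s, ‖blockOp i.1.1 (e i.1) (c i.1) i.2 x‖ ^ 2 ≤ 8 * ‖x‖ ^ 2 := by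
  classical
  let A : TrunkIndex n × ℕ → Set Node := fun i =>
    trunkSet i.1.1 (e i.1 (i.2 - 1)) (e i.1 (i.2 + 1))
  have hA : ∀ i, IsOrdConvex (A i) := fun i => isOrdConvex_trunkSet _ _ _
  -- On one trunk only neighbouring blocks can overlap, so each parity class has disjoint supports.
  -- Two classes and the factor 2 of `norm_blockOp_le` give 8 = 2 · 2².
  have hpar : ∀ (r : ℕ), ∑ i ∈ s.filter (fun i => i.2 % 2 = r), ‖restrict (A i) (hA i) x‖ ^ 2 ≤
      ‖x‖ ^ 2 := by
    intro r
    refine sum_norm_sq_restrict_le _ A hA (fun i hi j hj hij => ?_) x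
    refine disjoint_trunkSet i.1.2.2 j.1.2.2 fun hp => ?_
    have h1 : i.1 = j.1 := Subtype.ext hp
    have h2 : i.2 ≠ j.2 := fun h2 => hij (Prod.ext h1 h2)
    have h3 : i.2 % 2 = r := (Finset.mem_filter.1 hi).2
    have h4 : j.2 % 2 = r := (Finset.mem_filter.1 hj).2
    rw [h1]
    rcases lt_or_gt_of_ne h2 with h5 | h5
    · left
      exact (h j.1).strictMono.monotone (by omega)
    · right
      exact (h j.1).strictMono.monotone (by omega)
  have hsplit : ∑ i ∈ s, ‖restrict (A i) (hA i) x‖ ^ 2 =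
      ∑ i ∈ s.filter (fun i => i.2 % 2 = 0), ‖restrict (A i) (hA i) x‖ ^ 2 +
        ∑ i ∈ s.filter (fun i => i.2 % 2 = 1), ‖restrict (A i) (hA i) x‖ ^ 2 := by
    rw [← Finset.sum_filter_add_sum_filter_not s fun i => i.2 % 2 = 0]
    congr 2
    refine Finset.filter_congr fun i _ => ?_
    omega
  have hle : ∑ i ∈ s, ‖blockOp i.1.1 (e i.1) (c i.1) i.2 x‖ ^ 2 ≤
      ∑ i ∈ s, 4 * ‖restrict (A i) (hA i) x‖ ^ 2 := by
    refine Finset.sum_le_sum fun i _ => ?_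
    have h1 := (h i.1).norm_blockOp_le (p := i.1.1) i.2 x
    calc _ ≤ (2 * ‖restrict (A i) (hA i) x‖) ^ 2 := pow_le_pow_left₀ (norm_nonneg _) h1 2
      _ = _ := by ring
  rw [← Finset.mul_sum, hsplit] at hle
  linarith [hpar 0, hpar 1]

lemma norm_sum_blockOp_sq_le (h : ∀ p, IsBlockSystem (e p) (c p)) (s : Finset (TrunkIndex n × ℕ))
    (x : TrunkIndex n × ℕ → JT) :
    ‖∑ i ∈ s, blockOp i.1.1 (e i.1) (c i.1) i.2 (x i)‖ ^ 2 ≤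
      (2 * (3 * (n + 1)) : ℕ) * ∑ i ∈ s, ‖blockOp i.1.1 (e i.1) (c i.1) i.2 (x i)‖ ^ 2 :=
  norm_sum_sq_le_of_card s _ _ <| card_filter_pathSum_ne_zero_le (fun p => (h p).zero)
    (fun p => (h p).strictMono) s _ (fun i _ hα => (h i.1).coeff_blockOp i.2 (x i) hα)
    fun i hi => branchL_blockOp _ _ _ hi (x i)

lemma exists_sum_blockOp (h : ∀ p, IsBlockSystem (e p) (c p)) :
    ∃ W : JT →L[ℝ] JT,
      (∀ x, HasSum (fun i : TrunkIndex n × ℕ => blockOp i.1.1 (e i.1) (c i.1) i.2 x) (W x)) ∧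
      (∀ φ : JT →L[ℝ] ℝ, ∀ δ > 0, ∃ (A : Finset Node) (a : Node → ℝ), ∀ x, ‖x‖ ≤ 1 →
        |φ (W x) - ∑ α ∈ A, a α * x.coeff α| ≤ δ) ∧ ∀ x, W x ∈ X n := by
  classical
  obtain ⟨W, hW⟩ := exists_hasSum_operator (Nat.cast_nonneg _) (norm_sum_blockOp_sq_le h)
    (sum_norm_sq_blockOp_le h)
  refine ⟨W, hW, fun φ δ hδ => ?_, fun x => mem_X_iff.2 fun α hα => ?_⟩
  · obtain ⟨s, hs⟩ := exists_finset_dual_sub_sum_le (norm_sum_blockOp_sq_le h)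
      (sum_norm_sq_blockOp_le h) (Nat.cast_nonneg _) (by norm_num) hW φ hδ
    choose A hA using fun i : TrunkIndex n × ℕ => (h i.1).exists_blockOp_eq i.1.1 i.2
    refine ⟨s.biUnion A, fun α => ∑ i ∈ s, if α ∈ A i then
      φ (blockOp i.1.1 (e i.1) (c i.1) i.2 (nodeVec α)) else 0, fun x hx => ?_⟩
    refine le_trans (le_of_eq ?_) (hs x hx)
    congr 2
    simp only [Finset.sum_mul]
    rw [Finset.sum_comm]
    refine Finset.sum_congr rfl fun i hi => ?_
    conv_rhs => rw [hA i x, map_sum]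
    symm
    rw [← Finset.sum_subset (Finset.subset_biUnion_of_mem A hi)]
    · refine Finset.sum_congr rfl fun α hα => ?_
      rw [if_pos hα, map_smul, smul_eq_mul, mul_comm]
    · intro α _ hα
      rw [if_neg hα, zero_mul]
  · have h1 := (coeffL α).hasSum (hW x)
    refine h1.unique ?_
    convert hasSum_zero using 1
    funext i
    refine (h i.1).coeff_blockOp i.2 x ?_
    rintro ⟨k, -, -, rfl⟩
    exact hα (trunkNode_mem_subtree i.1.2.1 k)

/-- On `X_n`, the operator `∑ V_i` differs from the identity by the sum of the excesses. -/
lemma hasSum_coeff_blockStep (h : ∀ p, IsBlockSystem (e p) (c p)) {x : JT} (hx : x ∈ X n)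
    (α : Node) :
    HasSum (fun i : TrunkIndex n × ℕ => (blockStep i.1.1 (e i.1) (c i.1) i.2 x).coeff α)
      (x.coeff α) := by
  classical
  obtain ⟨p, k, hp, rfl⟩ := exists_isTrunkStart α
  have hoff : ∀ i : TrunkIndex n × ℕ, i.1.1 ≠ p →
      (blockStep i.1.1 (e i.1) (c i.1) i.2 x).coeff (trunkNode p k) = 0 := by
    intro i hi
    refine (h i.1).coeff_blockStep i.2 x ?_
    rintro ⟨l, -, -, hl⟩
    exact hi (hp.eq i.1.2.2 hl).symm
  by_cases hpn : p ∈ subtree n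
  · let P : TrunkIndex n := ⟨p, hpn, hp⟩
    have hk : k ≤ e P (k + 1) := (Nat.le_succ k).trans ((h P).strictMono.id_le (k + 1))
    -- Since e j ≥ j, only the blocks up to k + 1 of this trunk reach level `k`; they telescope to
    -- an average that fixes this coordinate.
    have h1 : x.coeff (trunkNode p k) = ∑ i ∈ ({P} : Finset (TrunkIndex n)) ×ˢ Finset.range (k + 2),
        (blockStep i.1.1 (e i.1) (c i.1) i.2 x).coeff (trunkNode p k) := by
      rw [Finset.sum_product, Finset.sum_singleton, ← coeff_sum, ← sum_apply]
      change _ = ((∑ i ∈ Finset.range (k + 2), blockStep p (e P) (c P) i) x).coeff _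
      rw [sum_blockStep]
      exact (coeff_trunkAvg_of_le ((h P).sum_eq_one (k + 1)) hk x).symm
    rw [h1]
    refine hasSum_sum_of_ne_finset_zero fun i hi => ?_
    by_cases hip : i.1.1 = p
    · have hiP : i.1 = P := Subtype.ext hip
      have hik : k + 1 < i.2 := by
        by_contra hcon
        exact hi (Finset.mem_product.2 ⟨by simp [hiP], Finset.mem_range.2 (by omega)⟩)
      refine (h i.1).coeff_blockStep i.2 x ?_
      rw [hip, trunkNode_mem_trunkSet, hiP]
      intro hcon
      have : i.2 - 1 ≤ e P (i.2 - 1) := (h P).strictMono.id_le _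
      omega
    · exact hoff i hip
  · have h1 : x.coeff (trunkNode p k) = 0 := mem_X_iff.1 hx _ (by simpa [subtree] using hpn)
    rw [h1]
    convert hasSum_zero using 1
    funext i
    refine hoff i ?_
    rintro rfl
    exact hpn i.1.2.1

end BlockSum

end JT

open JT

section Enorm

variable {E : Type*} [NormedAddCommGroup E] {D : Set E} {f : E → E}

lemma iSup_enorm_sub_lt {ε : ℝ} (hε : 0 < ε) (h : ∀ x ∈ D, ‖x - f x‖ ≤ ε / 2) :
    (⨆ x ∈ D, ‖x - f x‖ₑ) < ENNReal.ofReal ε := by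
  refine lt_of_le_of_lt (iSup₂_le (a := ENNReal.ofReal (ε / 2)) fun x hx => ?_)
    ((ENNReal.ofReal_lt_ofReal_iff hε).2 (half_lt_self hε))
  rw [← ofReal_norm]
  exact ENNReal.ofReal_le_ofReal (h x hx)

lemma norm_sub_le_of_iSup_lt {ε : ℝ} (hε : 0 < ε) (h : (⨆ x ∈ D, ‖x - f x‖ₑ) < ENNReal.ofReal ε)
    {x : E} (hx : x ∈ D) : ‖x - f x‖ ≤ ε := by
  have h1 : ‖x - f x‖ₑ ≤ ⨆ x ∈ D, ‖x - f x‖ₑ := le_iSup₂ (f := fun x _ => ‖x - f x‖ₑ) x hx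
  have h2 := h1.trans_lt h
  rw [← ofReal_norm] at h2
  exact ((ENNReal.ofReal_lt_ofReal_iff hε).1 h2).le

end Enorm

/-! ### The unbounded W.A.P. of `X_n` -/

namespace JT

/-- On the weak compactum `D` the tails of the branch sum are continuous, uniformly bounded and
pointwise null, so `exists_convexCombination_lt` applies. -/
lemma exists_small_average {D : Set JT} (hD : IsWeaklyCompact JT D) (p : Node) (m : ℕ) {η : ℝ}
    (hη : 0 < η) :
    ∃ (e : ℕ) (c : ℕ → ℝ), (∀ k, 0 ≤ c k) ∧ ∑ k ∈ Finset.Ico m e, c k = 1 ∧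
      ∀ x ∈ D, |∑ k ∈ Finset.Ico m e, c k * (branchL p x - pathSum (trunkNode p k) x.coeff)| < η := by
  obtain ⟨M, hM⟩ := hD.exists_norm_le
  have hcs : CompactSpace (toWeakSpace ℝ JT '' D) := isCompact_iff_compactSpace.1 hD
  let g : ℕ → C(toWeakSpace ℝ JT '' D, ℝ) := fun k =>
    ⟨fun w => (branchL p - pathSumL (trunkNode p k)) ((toWeakSpace ℝ JT).symm w.1),
      (continuous_dual_weakSpace _).comp continuous_subtype_val⟩
  have hg : ∀ k (x : JT) (hx : x ∈ D), g k ⟨toWeakSpace ℝ JT x, x, hx, rfl⟩ =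
      branchL p x - pathSum (trunkNode p k) x.coeff := fun k x hx => by
    simp [g]
  obtain ⟨e, c, hc, hc1, hce⟩ := exists_convexCombination_lt g (M := 2 * M)
    (by
      rintro k ⟨_, x, hx, rfl⟩
      rw [hg k x hx]
      have h1 := abs_branchL_le p x
      have h2 := abs_pathSum_le (trunkNode p k) x
      have h3 := hM x hx
      exact (abs_sub _ _).trans (by linarith))
    (by
      rintro ⟨_, x, hx, rfl⟩
      simp only [hg _ x hx]
      simpa using (tendsto_branchL p x).const_sub (branchL p x)) m hη
  refine ⟨e, c, hc, hc1, fun x hx => ?_⟩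
  have := hce ⟨toWeakSpace ℝ JT x, x, hx, rfl⟩
  simpa only [hg _ x hx] using this

lemma exists_blockSystem {D : Set JT} (hD : IsWeaklyCompact JT D) (p : Node) {η : ℕ → ℝ}
    (hη : ∀ j, 0 < η j) :
    ∃ (e : ℕ → ℕ) (c : ℕ → ℕ → ℝ), IsBlockSystem e c ∧ ∀ j, ∀ x ∈ D,
      |∑ k ∈ Finset.Ico (e j) (e (j + 1)),
        c j k * (branchL p x - pathSum (trunkNode p k) x.coeff)| ≤ η j := by
  choose E C hC0 hC1 hCη using fun (j m : ℕ) => exists_small_average hD p m (hη j)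
  let e : ℕ → ℕ := fun j => Nat.rec 0 (fun j m => E j m) j
  have he : ∀ j, e (j + 1) = E j (e j) := fun _ => rfl
  refine ⟨e, fun j => C j (e j), ⟨rfl, strictMono_nat_of_lt_succ fun j => ?_,
    fun j => hC0 j (e j), fun j => hC1 j (e j)⟩, fun j x hx => (hCη j (e j) x hx).le⟩
  -- Over an empty block the weights would sum to 0 instead of 1.
  by_contra hcon
  have h1 := hC1 j (e j)
  rw [← he, Finset.Ico_eq_empty_of_le (not_lt.1 hcon)] at h1
  simp at h1

end JT

theorem hasUnboundedWAP_X (n : ℕ) : HasUnboundedWAP (X n) := by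
  intro D hD ε hε
  have hD' : IsWeaklyCompact JT ((X n).subtypeL '' D) := hD.image _
  let _ : Encodable (TrunkIndex n × ℕ) := Encodable.ofCountable _
  obtain ⟨w, hw, t, hwt, hcε⟩ := posSumOfEncodable (half_pos hε) (TrunkIndex n × ℕ)
  -- Average j enters the excesses of blocks j and j + 1, so its tolerance is at most half of either
  -- weight.
  choose e c hec hη using fun p : TrunkIndex n => exists_blockSystem hD' p.1
    (η := fun j => min (w (p, j)) (w (p, j + 1)) / 2) fun j =>
      half_pos (lt_min (hw _) (hw _))
  obtain ⟨W, hW, hWc, hWX⟩ := exists_sum_blockOp hec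
  let W' : JT →L[ℝ] X n := W.codRestrict (X n) hWX
  have hW' : MapsBallToWeaklyCompact W' := by
    refine mapsBallToWeaklyCompact_of_coordinates W' fun φ δ hδ => ?_
    -- Weak compactness is needed in X_n, not only in JT, so functionals on X_n are extended to JT.
    obtain ⟨ψ, hψ, -⟩ := exists_extension_norm_eq (X n) φ
    obtain ⟨A, a, ha⟩ := hWc ψ δ hδ
    refine ⟨A, a, fun x hx => ?_⟩
    rw [← hψ]
    exact ha x hx
  refine ⟨W'.comp (X n).subtypeL, (isWeaklyCompactOperator_iff _).2
    (hW'.comp_right fun x => le_rfl), iSup_enorm_sub_lt hε fun x hx => ?_⟩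
  have hxD : (x : JT) ∈ (X n).subtypeL '' D := ⟨x, hx, rfl⟩
  have hexc : ∀ i : TrunkIndex n × ℕ, ‖blockExcess i.1.1 (e i.1) (c i.1) i.2 (x : JT)‖ ≤ w i := by
    rintro ⟨p, j⟩
    cases j with
    | zero =>
      simp only [blockExcess, zero_apply, norm_zero]
      exact (hw _).le
    | succ j =>
      have h1 := (hec p).norm_blockExcess_le (p := p.1) j x (η := w (p, j + 1) / 2)
        ((hη p j x hxD).trans (by gcongr; exact min_le_right _ _))
        ((hη p (j + 1) x hxD).trans (by gcongr; exact min_le_left _ _))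
      linarith
  -- Checked on coordinates: the steps add up to `x` and the block operators to `W x`.
  have hsum : HasSum (fun i : TrunkIndex n × ℕ => blockExcess i.1.1 (e i.1) (c i.1) i.2 (x : JT))
      ((x : JT) - W x) := by
    have h1 : Summable fun i : TrunkIndex n × ℕ =>
        blockExcess i.1.1 (e i.1) (c i.1) i.2 (x : JT) := Summable.of_norm_bounded hwt.summable hexc
    convert h1.hasSum
    rw [sub_eq_iff_eq_add']
    refine ext_coeff fun α => ?_
    refine (hasSum_coeff_blockStep hec x.2 α).unique ?_
    have h2 := (coeffL α).hasSum ((hW (x : JT)).add h1.hasSum)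
    refine h2.congr_fun fun i => ?_
    rw [blockOp, sub_apply, sub_add_cancel]
    rfl
  calc ‖x - (W'.comp (X n).subtypeL) x‖ = ‖(x : JT) - W x‖ := rfl
    _ ≤ t := hsum.norm_le_of_bounded hwt hexc
    _ ≤ ε / 2 := hcε

/-! ### The direct sum -/

/-- The inclusion of the `n`-th summand of `Z`. -/
def inclZ (n : ℕ+) : X n →L[ℝ] Z := lp.singleContinuousLinearMap ℝ (fun n : ℕ+ => X n) 1 n

/-- The projection onto the `n`-th summand of `Z`. -/
def projZ (n : ℕ+) : Z →L[ℝ] X n := lp.evalCLM ℝ (fun n : ℕ+ => X n) 1 n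

lemma norm_inclZ (n : ℕ+) (x : X n) : ‖inclZ n x‖ = ‖x‖ := by
  rw [inclZ, lp.singleContinuousLinearMap_apply]
  exact lp.norm_single (E := fun n : ℕ+ => X n) one_pos n x

lemma norm_projZ_le (n : ℕ+) (x : Z) : ‖projZ n x‖ ≤ ‖x‖ := lp.norm_apply_le_norm one_ne_zero x n

lemma projZ_inclZ (n : ℕ+) (x : X n) : projZ n (inclZ n x) = x := by
  rw [inclZ, lp.singleContinuousLinearMap_apply]
  exact lp.single_apply_self (E := fun n : ℕ+ => X n) 1 n x

lemma sum_norm_projZ_le (x : Z) (N : ℕ) :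
    ∑ i ∈ Finset.range N, ‖projZ i.succPNat x‖ ≤ ‖x‖ := by
  have h := lp.sum_rpow_le_norm_rpow (p := 1) (by simp) x
    ((Finset.range N).map ⟨Nat.succPNat, Nat.succPNat_injective⟩)
  simp only [ENNReal.toReal_one, Real.rpow_one, Finset.sum_map] at h
  exact h

lemma tendsto_sum_inclZ_projZ (x : Z) :
    Filter.Tendsto (fun N => ∑ i ∈ Finset.range N, inclZ i.succPNat (projZ i.succPNat x))
      Filter.atTop (nhds x) := by
  have h := lp.hasSum_single (p := 1) ENNReal.one_ne_top x
  have h2 := (Equiv.pnatEquivNat.symm.hasSum_iff).2 h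
  exact h2.tendsto_sum_nat

theorem hasUnboundedWAP_Z : HasUnboundedWAP Z := by
  intro D hD ε hε
  obtain ⟨N, hN⟩ := hD.exists_tail_le (P := fun i => projZ i.succPNat) sum_norm_projZ_le
    (show 0 < ε / 4 by positivity)
  -- Dividing by N + 1 keeps the tolerance positive when N = 0.
  have hδ : 0 < ε / 4 / (N + 1) := by positivity
  choose V hVc hV using fun i : ℕ =>
    hasUnboundedWAP_X i.succPNat (projZ i.succPNat '' D) (hD.image _) _ hδ
  refine ⟨∑ i ∈ Finset.range N, (inclZ i.succPNat).comp ((V i).comp (projZ i.succPNat)),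
    (isWeaklyCompactOperator_iff _).2 (MapsBallToWeaklyCompact.sum _ fun i _ =>
      (((isWeaklyCompactOperator_iff _).1 (hVc i)).comp_right (norm_projZ_le _)).comp_left _),
    iSup_enorm_sub_lt hε fun x hx => ?_⟩
  have h1 : ‖x - ∑ i ∈ Finset.range N, inclZ i.succPNat (projZ i.succPNat x)‖ ≤ ε / 4 := by
    refine le_of_tendsto ((tendsto_sum_inclZ_projZ x).sub_const _).norm
      (Filter.eventually_atTop.2 ⟨N, fun M hM => ?_⟩)
    rw [← Finset.sum_range_add_sum_Ico _ hM, add_sub_cancel_left]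
    refine (norm_sum_le _ _).trans (le_trans (le_of_eq ?_) (hN x hx M))
    exact Finset.sum_congr rfl fun i _ => norm_inclZ _ _
  have h2 : ‖∑ i ∈ Finset.range N, inclZ i.succPNat (projZ i.succPNat x - V i (projZ i.succPNat x))‖
      ≤ ε / 4 := by
    refine (norm_sum_le _ _).trans ?_
    calc _ ≤ ∑ i ∈ Finset.range N, ε / 4 / (N + 1) := by
          refine Finset.sum_le_sum fun i _ => ?_
          rw [norm_inclZ]
          exact norm_sub_le_of_iSup_lt hδ (hV i) ⟨x, hx, rfl⟩
      _ = N * (ε / 4 / (N + 1)) := by simp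
      _ ≤ ε / 4 := by
          rw [mul_div_assoc', div_le_iff₀ (by positivity)]
          nlinarith
  have h3 : x - (∑ i ∈ Finset.range N, (inclZ i.succPNat).comp ((V i).comp (projZ i.succPNat))) x =
      (x - ∑ i ∈ Finset.range N, inclZ i.succPNat (projZ i.succPNat x)) +
      ∑ i ∈ Finset.range N, inclZ i.succPNat (projZ i.succPNat x - V i (projZ i.succPNat x)) := by
    simp only [sum_apply, ContinuousLinearMap.comp_apply, map_sub, Finset.sum_sub_distrib]
    abel
  rw [h3]
  linarith [norm_add_le (x - ∑ i ∈ Finset.range N, inclZ i.succPNat (projZ i.succPNat x))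
    (∑ i ∈ Finset.range N, inclZ i.succPNat (projZ i.succPNat x - V i (projZ i.succPNat x)))]

/-! ### Failure of the bounded W.A.P. -/

/-- The projection of `JT` onto `X_n`. -/
def projX (n : ℕ) : JT →L[ℝ] X n :=
  (restrict (subtree n) (isOrdConvex_subtree n)).codRestrict (X n) fun x => by
    classical
    exact mem_X_iff.2 fun α hα => by rw [coeff_restrict, if_neg hα]

lemma coe_projX (n : ℕ) (x : JT) :
    (projX n x : JT) = restrict (subtree n) (isOrdConvex_subtree n) x := rfl

lemma norm_projX_le (n : ℕ) (x : JT) : ‖projX n x‖ ≤ ‖x‖ :=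
  norm_restrict_le (isOrdConvex_subtree n) x

lemma projX_of_mem {n : ℕ} {x : JT} (hx : x ∈ X n) : (projX n x : JT) = x := by
  classical
  refine ext_coeff fun α => ?_
  rw [coe_projX, coeff_restrict]
  split_ifs with h
  · rfl
  · exact (mem_X_iff.1 hx α h).symm

lemma nodeDiff_mem_X {n : ℕ} {α : Node} (hα : α ∈ subtree n) : nodeDiff α ∈ X n := by
  refine Submodule.sub_mem _ (nodeVec_mem_X hα) (nodeVec_mem_X ?_)
  simpa [subtree] using hα

/-- The differences of consecutive nodes of `T_n`, together with `0`, in the `n`-th summand. -/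
def diffSet (n : ℕ+) : Set Z :=
  insert 0 (Set.range fun α : subtree n => inclZ n (projX n (nodeDiff α)))

/-- The √card bound on finite sums makes the family weakly null along the cofinite filter; adding
the limit 0 makes it compact. -/
lemma isWeaklyCompact_diffSet (n : ℕ+) : IsWeaklyCompact Z (diffSet n) := by
  classical
  have h1 : ∀ s : Finset (subtree n), ‖∑ α ∈ s, inclZ n (projX n (nodeDiff α))‖ ≤
      2 * (n + 2) * √2 * √s.card := by
    intro s
    rw [← map_sum, norm_inclZ, ← map_sum]
    refine (norm_projX_le _ _).trans ?_
    have h2 := norm_sum_nodeDiff_le (n := n) (s := s.map (Function.Embedding.subtype _)) (by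
      intro α hα
      obtain ⟨β, -, rfl⟩ := Finset.mem_map.1 hα
      exact β.2)
    rw [Finset.sum_map, Finset.card_map] at h2
    exact h2
  have h3 : Filter.Tendsto (fun α : subtree n => toWeakSpace ℝ Z (inclZ n (projX n (nodeDiff α))))
      Filter.cofinite (nhds (toWeakSpace ℝ Z 0)) := by
    refine tendsto_weakSpace_of_forall fun φ => ?_
    rw [map_zero]
    exact tendsto_cofinite_of_norm_sum_le h1 φ
  have h4 := h3.isCompact_insert_range_of_cofinite
  rw [IsWeaklyCompact, diffSet, Set.image_insert_eq, ← Set.range_comp]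
  exact h4

theorem not_hasBoundedWAP_Z : ¬ HasBoundedWAP Z := by
  rintro ⟨C, hC⟩
  -- `le_norm_of_approximates` will give n/2 ≤ 7C√n, that is √n ≤ 14C.
  obtain ⟨m, hm⟩ := exists_nat_gt ((14 * C) ^ 2)
  set n : ℕ+ := m.succPNat with hn
  obtain ⟨V, hVc, hVD, hVC⟩ := hC _ (isWeaklyCompact_diffSet n) (1 / 4) (by norm_num)
  have hC0 : 0 ≤ C := (norm_nonneg V).trans hVC
  obtain ⟨K, hK, hVK⟩ := (isWeaklyCompactOperator_iff V).1 hVc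
  -- The compression of `V` to the n-th summand, extended to JT by the contractive projection onto
  -- X_n.
  let T : JT →L[ℝ] JT :=
    ((X n).subtypeL.comp (projZ n)).comp (V.comp ((inclZ n).comp (projX n)))
  have hTapply : ∀ x, T x = (projZ n (V (inclZ n (projX n x))) : JT) := fun _ => rfl
  have hTC : ‖T‖ ≤ C := by
    refine T.opNorm_le_bound hC0 fun x => ?_
    calc ‖T x‖ ≤ ‖V (inclZ n (projX n x))‖ := norm_projZ_le n _
      _ ≤ C * ‖inclZ n (projX n x)‖ := V.le_of_opNorm_le hVC _
      _ ≤ C * ‖x‖ := by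
        rw [norm_inclZ]
        exact mul_le_mul_of_nonneg_left (norm_projX_le _ _) hC0
  have hmain := le_norm_of_approximates T n
    (fun α hα => by
      have h1 := norm_sub_le_of_iSup_lt (by norm_num) hVD
        (Set.mem_insert_of_mem _ ⟨⟨α, hα⟩, rfl⟩)
      rw [norm_sub_rev] at h1
      refine le_trans ?_ ((norm_projZ_le n _).trans h1)
      rw [map_sub, projZ_inclZ]
      refine le_of_eq ?_
      rw [hTapply]
      exact congrArg (fun y : JT => ‖(projZ n (V (inclZ n (projX n (nodeDiff α)))) : JT) - y‖)
        (projX_of_mem (nodeDiff_mem_X hα)).symm)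
    (fun p hp => by
      obtain ⟨v, -, hv⟩ := exists_weak_cluster hK
        (u := fun k => V (inclZ n (projX n (nodeVec (trunkNode p k))))) fun k => hVK _ (by
          rw [norm_inclZ]
          exact (norm_projX_le _ _).trans (norm_nodeVec_le _))
      refine ⟨(projZ n v : JT), fun ψ δ hδ k₀ => ?_⟩
      obtain ⟨k, hk, hk'⟩ := hv {ψ.comp ((X n).subtypeL.comp (projZ n))} (fun _ => δ)
        (by simp [hδ]) k₀
      refine ⟨k, hk, ?_⟩
      have h1 := (hk' _ (Finset.mem_singleton_self _)).le
      rw [map_sub] at h1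
      rw [map_sub]
      exact h1)
  have hnm : (m : ℝ) < ((n : ℕ) : ℝ) := by
    rw [hn]
    simp
  have hn0 : (0 : ℝ) < ((n : ℕ) : ℝ) := (Nat.cast_nonneg m).trans_lt hnm
  have h1 : 14 * C < √((n : ℕ) : ℝ) := Real.lt_sqrt_of_sq_lt (hm.trans hnm)
  have h2 : √((n : ℕ) : ℝ) * √((n : ℕ) : ℝ) = (n : ℕ) := Real.mul_self_sqrt hn0.le
  have h3 : 0 < √((n : ℕ) : ℝ) := Real.sqrt_pos.2 hn0
  have h4 : ‖T‖ * (7 * √((n : ℕ) : ℝ)) ≤ C * (7 * √((n : ℕ) : ℝ)) :=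
    mul_le_mul_of_nonneg_right hTC (by positivity)
  nlinarith

theorem HasBoundedWAP.hasUnboundedWAP {E : Type*} [NormedAddCommGroup E] [NormedSpace ℝ E]
    (h : HasBoundedWAP E) : HasUnboundedWAP E := by
  obtain ⟨C, hC⟩ := h
  intro D hD ε hε
  obtain ⟨V, hV, hVD, -⟩ := hC D hD ε hε
  exact ⟨V, hV, hVD⟩

end WAP

end

theorem mainTheorem8 :
    (WAP.HasUnboundedWAP WAP.Z ∧ ¬ WAP.HasBoundedWAP WAP.Z) ∧
    (∀ (E : Type*) [NormedAddCommGroup E] [NormedSpace ℝ E] [CompleteSpace E],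
      WAP.HasBoundedWAP E → WAP.HasUnboundedWAP E) ∧
    (∃ (E : Type) (_ : NormedAddCommGroup E) (_ : NormedSpace ℝ E) (_ : CompleteSpace E),
      WAP.HasUnboundedWAP E ∧ ¬ WAP.HasBoundedWAP E) :=
  ⟨⟨WAP.hasUnboundedWAP_Z, WAP.not_hasBoundedWAP_Z⟩,
    fun _ _ _ _ h => h.hasUnboundedWAP,
    WAP.Z, inferInstance, inferInstance, inferInstance,
    WAP.hasUnboundedWAP_Z, WAP.not_hasBoundedWAP_Z⟩
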